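/- **Setting.** Let $(M,g)$ be a smooth Riemannian manifold without boundary (Hausdorff, $\sigma$-compact, possibly non-compact, connected or not). Let $\pi\colon\mathcal E\to M$ be a smooth real vector bundle of finite rank with a smooth fibre metric $\langle\,,\rangle$ and a smooth connection $\nabla$ compatible with $\langle\,,\rangle$, and let $\sigma$ be a smooth section of $\mathcal E$. **Definitions.** For $p,q\in\mathbb R$, a smooth section $\tau$ of $\mathcal E$ and a compact set $K\subset M$, the vertical $(p,q)$-energy of $\tau$ over $K$ is $$E^v_{p,q}(\tau;K)=\frac12\int_K \frac{1}{(1+|\tau|^2)^p}\sum_i\Bigl(|\nabla_{E_i}\tau|^2+q\,\langle\nabla_{E_i}\tau,\tau\rangle^2\Bigr)\operatorname{vol}(g),$$ where $(E_i)$ is a local orthonormal frame of $TM$. The section $\sigma$ is *$(p,q)$-harmonic* if $\frac{d}{dt}\big|_{t=0}E^v_{p,q}(\sigma_t;K)=0$ for every compact $K\subset M$ and every smooth variation $(\sigma_t)_{t\in\mathbb R}$ of $\sigma=\sigma_0$ through sections of $\mathcal E$ with $\sigma_t=\sigma$ outside $K$. It is *parallel* if $\nabla\sigma=0$. For $r\in\mathbb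 R$, it is *$r$-Riemannian* if $r\,|\sigma(x)|^2\ge-1$ for all $x\in M$. A function on $M$ is *harmonic* if it is annihilated by the Laplace–Beltrami operator of $g$. For $\mu>0$ put $$\mathcal F_-(\mu)=\{(p,q)\in\mathbb R^2:p<0,\ \mu q\le 2p\},\qquad \mathcal F_0=\{(p,q)\in\mathbb R^2:0\le p\le1\},$$ $$\mathcal F_1(\mu)=\{(p,q)\in\mathbb R^2:p>1,\ \mu q<1-p\},\qquad \mathcal F(\mu)=\mathcal F_-(\mu)\cup\mathcal F_0\cup\mathcal F_1(\mu).$$ **Theorem 4.3.** Suppose that $\mu\ge\frac12$, that $(p,q)\in\mathcal F(\mu)$, that $\sigma$ is $\mu q$-Riemannian, and that $|\sigma|^2$ is a harmonic function on $M$. Then $\sigma$ is a $(p,q)$-harmonic section of $\mathcal E$ if and only if $\sigma$ is parallel. -/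

import Mathlib

open Bundle Manifold MeasureTheory
open scoped ContDiff

noncomputable section

namespace PQHarmonic

/-! ### The base: Riemannian volume and Laplace-Beltrami operator

`M` is a smooth manifold without boundary, modelled on `ℝⁿ`, with a Riemannian metric on its
tangent bundle. -/

section Base

variable {n : ℕ} {M : Type*} [TopologicalSpace M] [ChartedSpace (EuclideanSpace ℝ (Fin n)) M]

/-- The coordinate vector `∂ᵢ` of a chart `e`, at the point of `M` with coordinates `u`. -/
def coordVec (e : OpenPartialHomeomorph M (EuclideanSpace ℝ (Fin n)))
    (u : EuclideanSpace ℝ (Fin n)) (i : Fin n) : TangentSpace (𝓡 n) (e.symm u) :=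
  mfderiv (𝓡 n) (𝓡 n) e.symm u (EuclideanSpace.single i (1 : ℝ))

/-- The `i`-th partial derivative at `u` of a function on `ℝⁿ`. -/
def partialDeriv (i : Fin n) (f : EuclideanSpace ℝ (Fin n) → ℝ)
    (u : EuclideanSpace ℝ (Fin n)) : ℝ :=
  fderiv ℝ f u (EuclideanSpace.single i (1 : ℝ))

variable [RiemannianBundle (fun x : M ↦ TangentSpace (𝓡 n) x)]

/-- The matrix `g i j = g(∂ᵢ, ∂ⱼ)` of the metric in the chart `e`, as a function of the
coordinates. -/
def gram (e : OpenPartialHomeomorph M (EuclideanSpace ℝ (Fin n)))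
    (u : EuclideanSpace ℝ (Fin n)) : Matrix (Fin n) (Fin n) ℝ :=
  Matrix.of fun i j ↦ inner ℝ (coordVec e u i) (coordVec e u j)

/-- The density `√(det g)` of the Riemannian volume in the chart `e`. -/
def volDensity (e : OpenPartialHomeomorph M (EuclideanSpace ℝ (Fin n)))
    (u : EuclideanSpace ℝ (Fin n)) : ℝ :=
  √((gram e u).det)

/-- The Riemannian volume of the domain of the chart `e`, extended by zero to `M`: the measure
`√(det g) du¹ ⋯ duⁿ` on the image of the chart, transported to `M`. -/
def chartVolume [MeasurableSpace M]
    (e : OpenPartialHomeomorph M (EuclideanSpace ℝ (Fin n))) : Measure M :=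
  ((volume.restrict e.target).withDensity fun u ↦ ENNReal.ofReal (volDensity e u)).map e.symm

variable (n M) in
/-- The Riemannian volume measure of `M`. By the change of variables formula the measures
`chartVolume e` agree on overlaps of charts, so their supremum is the measure whose restriction to
the domain of each chart `e` of the atlas is `chartVolume e`. -/
def riemannianVolume [MeasurableSpace M] : Measure M :=
  ⨆ e : atlas (EuclideanSpace ℝ (Fin n)) M, chartVolume e.1

/-- The Laplace-Beltrami operator in the chart `e`, with the sign convention `Δ = - trace ∇ d`:
`Δ f = - (1 / √(det g)) ∑ᵢ ∂ᵢ (√(det g) ∑ⱼ gⁱʲ ∂ⱼ f)`. -/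
def laplaceBeltrami (e : OpenPartialHomeomorph M (EuclideanSpace ℝ (Fin n))) (f : M → ℝ)
    (u : EuclideanSpace ℝ (Fin n)) : ℝ :=
  -((volDensity e u)⁻¹ * ∑ i, partialDeriv i
    (fun v ↦ volDensity e v * ∑ j, (gram e v)⁻¹ i j * partialDeriv j (f ∘ e.symm) v) u)

variable (n) in
/-- A `C²` function on `M` is harmonic if its Laplacian vanishes, in every chart of the atlas. -/
def IsHarmonicFunction (f : M → ℝ) : Prop :=
  ContMDiff (𝓡 n) 𝓘(ℝ, ℝ) 2 f ∧
    ∀ e ∈ atlas (EuclideanSpace ℝ (Fin n)) M, ∀ u ∈ e.target, laplaceBeltrami e f u = 0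

end Base

/-! ### Sections of a Riemannian vector bundle with a connection -/

section Sections

/-- The vertical part of the tensor `h_{p,q}` at the point `e` of a fibre `W`:
`w(e)^p (⟨a, b⟩ + q ⟨a, e⟩ ⟨b, e⟩)`, where `w(e) = 1 / (1 + |e|²)`. -/
def verticalMetric {W : Type*} [NormedAddCommGroup W] [InnerProductSpace ℝ W] (p q : ℝ)
    (e a b : W) : ℝ :=
  (1 / (1 + ‖e‖ ^ 2)) ^ p * (inner ℝ a b + q * inner ℝ a e * inner ℝ b e)

variable {n : ℕ} {M : Type*} [TopologicalSpace M] [ChartedSpace (EuclideanSpace ℝ (Fin n)) M]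
  {F : Type*} [NormedAddCommGroup F] [NormedSpace ℝ F]
  {V : M → Type*} [TopologicalSpace (TotalSpace F V)]
  [∀ x, NormedAddCommGroup (V x)] [∀ x, InnerProductSpace ℝ (V x)] [FiberBundle F V]

/-- `σ` is `q`-Riemannian if `q |σ(x)|² ≥ -1` for all `x`. -/
def IsRiemannianSection (q : ℝ) (σ : ∀ x, V x) : Prop :=
  ∀ x, -1 ≤ q * ‖σ x‖ ^ 2

/-- `σ` is parallel if `∇σ = 0`. -/
def IsParallel (cov : CovariantDerivative (𝓡 n) F V) (σ : ∀ x, V x) : Prop :=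
  ∀ x, cov σ x = 0

/-- The smooth one-parameter variations `s t`, `t ∈ ℝ`, of `σ` through sections, which leave `σ`
unchanged outside the set `K`. -/
structure IsVariation (n : ℕ) {M : Type*} [TopologicalSpace M]
    [ChartedSpace (EuclideanSpace ℝ (Fin n)) M]
    (F : Type*) [NormedAddCommGroup F] [NormedSpace ℝ F]
    {V : M → Type*} [TopologicalSpace (TotalSpace F V)]
    [∀ x, NormedAddCommGroup (V x)] [∀ x, InnerProductSpace ℝ (V x)] [FiberBundle F V]
    (K : Set M) (σ : ∀ x, V x) (s : ℝ → ∀ x, V x) : Prop where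
  smooth : ContMDiff ((𝓡 n).prod 𝓘(ℝ, ℝ)) ((𝓡 n).prod 𝓘(ℝ, F)) ∞
    (fun z : M × ℝ ↦ TotalSpace.mk' F z.1 (s z.2 z.1))
  zero : s 0 = σ
  eq_off : ∀ t, ∀ x ∉ K, s t x = σ x

variable [RiemannianBundle (fun x : M ↦ TangentSpace (𝓡 n) x)]

/-- The squared norm `|dᵛσ|² = ∑ᵢ h_{p,q}(dᵛσ(Eᵢ), dᵛσ(Eᵢ))` of the vertical differential, where
`(Eᵢ)` is an orthonormal basis of the tangent space at `x`. The connection map carries `dᵛσ(X)` to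
`∇_X σ`. -/
def verticalDensity (cov : CovariantDerivative (𝓡 n) F V) (p q : ℝ) (σ : ∀ x, V x) (x : M) : ℝ :=
  haveI : FiniteDimensional ℝ (TangentSpace (𝓡 n) x) :=
    inferInstanceAs (FiniteDimensional ℝ (EuclideanSpace ℝ (Fin n)))
  let E := stdOrthonormalBasis ℝ (TangentSpace (𝓡 n) x)
  ∑ i, verticalMetric p q (σ x) (cov σ x (E i)) (cov σ x (E i))

/-- The vertical `(p,q)`-energy of `σ` over the set `K`. -/
def verticalEnergy [MeasurableSpace M] (cov : CovariantDerivative (𝓡 n) F V) (p q : ℝ)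
    (K : Set M) (σ : ∀ x, V x) : ℝ :=
  1 / 2 * ∫ x in K, verticalDensity cov p q σ x ∂(riemannianVolume n M)

/-- `σ` is a `(p,q)`-harmonic section if it is a critical point of the vertical `(p,q)`-energy, with
respect to all smooth variations through sections supported in compact sets. -/
def IsHarmonicSection [MeasurableSpace M] (cov : CovariantDerivative (𝓡 n) F V) (p q : ℝ)
    (σ : ∀ x, V x) : Prop :=
  ∀ K : Set M, IsCompact K → ∀ s : ℝ → ∀ x, V x, IsVariation n F K σ s →
    HasDerivAt (fun t ↦ verticalEnergy cov p q K (s t)) 0 0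

end Sections

/-! ### Regions of the `(p,q)`-plane -/

def regionMinus (μ : ℝ) : Set (ℝ × ℝ) := {z | z.1 < 0 ∧ μ * z.2 ≤ 2 * z.1}

def regionZero : Set (ℝ × ℝ) := {z | 0 ≤ z.1 ∧ z.1 ≤ 1}

def regionOne (μ : ℝ) : Set (ℝ × ℝ) := {z | 1 < z.1 ∧ μ * z.2 < 1 - z.1}

def region (μ : ℝ) : Set (ℝ × ℝ) := regionMinus μ ∪ regionZero ∪ regionOne μ

end PQHarmonic

end

set_option linter.unusedSectionVars false

/-! Write `N = |σ|²`, `w = 1 / (1 + N)`, `a = |∇σ|²` and `b = ∑ₖ ⟨∇_{Eₖ}σ, σ⟩²`. The forward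
direction tests criticality only against the rescalings `(1 + tφ)σ`, where `φ` is a smooth function
with compact support in a chart. Metric compatibility gives `dN = 2⟨∇σ, σ⟩`. The derivative at `t =
0` of the integrand of twice the energy can then be written `2 φ w^(p+1) Q + ⟨d(φ ω(N)), dN⟩`, where
`ω(r) = (1 + r)^(-p) (1 + q r)` is `weight` and `Q = (1 + N - pN) a + p(2 + qN) b` is
`variationForm` (`hasDerivAt_verticalMetric`, `hasDerivAt_verticalDensity_scalingVariation`).

Since `N` is harmonic, Green's formula (`setIntegral_gradient_inner_eq_zero`) kills the integral of
the second term, so `∫ φ w^(p+1) Q = 0` for all such `φ`. By Cauchy-Schwarz `0 ≤ b ≤ N a`, and the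
conditions on `μ`, `p`, `q` are what make `Q ≥ c a` with some `c > 0` at each point
(`exists_pos_mul_le_of_mem_region`). Hence `Q ≥ 0`; taking `φ` a bump function forces `Q = 0` at its
centre, so `a = 0` there, that is `∇σ = 0`.

Conversely, if `∇σ = 0`, the energy density of any smooth variation vanishes to second order at `t =
0`; this needs neither the region nor the harmonicity of `N`.

The analytic support is the smoothness of the density in all variables
(`contDiffAt_verticalDensity`), the identification of the volume in a chart
(`riemannianVolume_restrict_source`), and differentiation under the integral sign. -/

namespace PQHarmonic

/-! ### Traces of bilinear forms in non-orthonormal bases -/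

section LinearAlgebra

variable {W ι κ : Type*} [NormedAddCommGroup W] [InnerProductSpace ℝ W] [Fintype ι] [DecidableEq ι]
  [Fintype κ]

/-- The trace of a bilinear form, in an orthonormal basis and in an arbitrary basis. -/
theorem sum_orthonormalBasis_eq_sum_gram_inv (E : OrthonormalBasis κ ℝ W) (v : Module.Basis ι ℝ W)
    (B : W →ₗ[ℝ] W →ₗ[ℝ] ℝ) :
    ∑ k, B (E k) (E k) =
      ∑ i, ∑ j, (Matrix.of fun i j ↦ inner ℝ (v i) (v j) : Matrix ι ι ℝ)⁻¹ i j * B (v i) (v j) := by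
  classical
  set P : Matrix κ ι ℝ := Matrix.of fun k i ↦ v.repr (E k) i with hP
  set A : Matrix ι κ ℝ := Matrix.of fun i k ↦ inner ℝ (E k) (v i) with hA
  have hv (i) : v i = ∑ k, A i k • E k := (E.sum_repr' (v i)).symm
  have hE (k) : E k = ∑ i, P k i • v i := (v.sum_repr (E k)).symm
  -- The index types of `A` and `P` differ, so both products are checked separately.
  have hAP : A * P = 1 := by
    ext i j
    have := congr(v.repr $(hv i) j)
    simp only [map_sum, map_smul, Finsupp.coe_finsetSum, Finset.sum_apply, Finsupp.smul_apply,
      smul_eq_mul, Module.Basis.repr_self] at this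
    rw [Matrix.mul_apply, Matrix.one_apply, show ∑ k, A i k * P k j = _ from this.symm,
      Finsupp.single_apply]
  have hPA : P * A = 1 := by
    ext k l
    have := congr(inner ℝ (E l) $(hE k))
    simp only [inner_sum, inner_smul_right] at this
    rw [Matrix.mul_apply, Matrix.one_apply, show ∑ i, P k i * A i l = _ from this.symm,
      orthonormal_iff_ite.1 E.orthonormal]
    simp [eq_comm]
  have hG : (Matrix.of fun i j ↦ inner ℝ (v i) (v j) : Matrix ι ι ℝ) = A * A.transpose := by
    ext i j
    rw [Matrix.mul_apply, Matrix.of_apply, ← E.sum_inner_mul_inner (v i) (v j)]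
    simp [hA, real_inner_comm]
  -- The Gram matrix is `A Aᵀ` and `P` is a two-sided inverse of `A`.
  have hinv : (Matrix.of fun i j ↦ inner ℝ (v i) (v j) : Matrix ι ι ℝ)⁻¹ = P.transpose * P := by
    rw [hG]
    apply Matrix.inv_eq_right_inv
    calc A * A.transpose * (P.transpose * P) = A * (P * A).transpose * P := by
          simp only [Matrix.transpose_mul, Matrix.mul_assoc]
      _ = 1 := by rw [hPA]; simp [hAP]
  rw [hinv]
  calc ∑ k, B (E k) (E k) = ∑ k, ∑ i, ∑ j, P k i * (P k j * B (v i) (v j)) := by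
        refine Finset.sum_congr rfl fun k _ ↦ ?_
        conv_lhs => rw [hE k]
        simp only [map_sum, map_smul, LinearMap.sum_apply, LinearMap.smul_apply, smul_eq_mul,
          Finset.mul_sum]
        rw [Finset.sum_comm]
        exact Finset.sum_congr rfl fun i _ ↦ Finset.sum_congr rfl fun j _ ↦ by ring
    _ = _ := by
        rw [Finset.sum_comm]
        refine Finset.sum_congr rfl fun i _ ↦ ?_
        rw [Finset.sum_comm]
        refine Finset.sum_congr rfl fun j _ ↦ ?_
        rw [Matrix.mul_apply, Finset.sum_mul]
        exact Finset.sum_congr rfl fun k _ ↦ by simp [Matrix.transpose_apply, mul_assoc]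

end LinearAlgebra

/-! ### Coordinate fields and metric coefficients in a chart -/

section Base

variable {n : ℕ} {M : Type*} [TopologicalSpace M] [ChartedSpace (EuclideanSpace ℝ (Fin n)) M]
  [IsManifold (𝓡 n) ∞ M] {e : OpenPartialHomeomorph M (EuclideanSpace ℝ (Fin n))}

theorem contMDiffOn_chart (he : e ∈ atlas (EuclideanSpace ℝ (Fin n)) M) :
    ContMDiffOn (𝓡 n) (𝓡 n) ∞ e e.source :=
  contMDiffOn_of_mem_maximalAtlas (IsManifold.subset_maximalAtlas he)

theorem contMDiffOn_chart_symm (he : e ∈ atlas (EuclideanSpace ℝ (Fin n)) M) :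
    ContMDiffOn (𝓡 n) (𝓡 n) ∞ e.symm e.target :=
  contMDiffOn_symm_of_mem_maximalAtlas (IsManifold.subset_maximalAtlas he)

theorem contMDiffAt_chart_symm (he : e ∈ atlas (EuclideanSpace ℝ (Fin n)) M)
    {u : EuclideanSpace ℝ (Fin n)} (hu : u ∈ e.target) : ContMDiffAt (𝓡 n) (𝓡 n) ∞ e.symm u :=
  (contMDiffOn_chart_symm he).contMDiffAt (e.open_target.mem_nhds hu)

theorem mdifferentiable_chart (he : e ∈ atlas (EuclideanSpace ℝ (Fin n)) M) :
    e.MDifferentiable (𝓡 n) (𝓡 n) :=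
  ⟨(contMDiffOn_chart he).mdifferentiableOn (by simp),
    (contMDiffOn_chart_symm he).mdifferentiableOn (by simp)⟩

/-- The field `∂ᵢ` is the tangent map of `e.symm` applied to a constant vector field on `ℝⁿ`. -/
theorem contMDiffOn_coordVec (he : e ∈ atlas (EuclideanSpace ℝ (Fin n)) M) (i : Fin n) :
    ContMDiffOn (𝓡 n) ((𝓡 n).prod 𝓘(ℝ, EuclideanSpace ℝ (Fin n))) ∞
      (fun u ↦ TotalSpace.mk' (EuclideanSpace ℝ (Fin n)) (E := TangentSpace (𝓡 n)) (e.symm u)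
        (coordVec e u i)) e.target := by
  have h1 := (contMDiffOn_chart_symm he).contMDiffOn_tangentMapWithin (m := ∞) le_rfl
    e.open_target.uniqueMDiffOn
  have h2 : ContMDiff (𝓡 n) ((𝓡 n).prod 𝓘(ℝ, EuclideanSpace ℝ (Fin n))) ∞
      (fun u : EuclideanSpace ℝ (Fin n) ↦ (⟨u, EuclideanSpace.single i (1 : ℝ)⟩ :
        TangentBundle (𝓡 n) (EuclideanSpace ℝ (Fin n)))) := fun u ↦
    contMDiffAt_vectorSpace_iff_contDiffAt.2 contDiffAt_const
  refine (h1.comp h2.contMDiffOn (s := e.target) fun u hu ↦ hu).congr fun u hu ↦ ?_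
  simp only [Function.comp, tangentMapWithin, coordVec]
  rw [mfderivWithin_of_mem_nhds (e.open_target.mem_nhds hu)]

/-- The coordinate vectors of a chart form a basis of each tangent space. -/
noncomputable def coordBasis (he : e ∈ atlas (EuclideanSpace ℝ (Fin n)) M)
    {u : EuclideanSpace ℝ (Fin n)} (hu : u ∈ e.target) :
    Module.Basis (Fin n) ℝ (TangentSpace (𝓡 n) (e.symm u)) :=
  (EuclideanSpace.basisFun (Fin n) ℝ).toBasis.map
    ((mdifferentiable_chart he).symm.mfderiv hu).toLinearEquiv

theorem coordBasis_apply (he : e ∈ atlas (EuclideanSpace ℝ (Fin n)) M)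
    {u : EuclideanSpace ℝ (Fin n)} (hu : u ∈ e.target) (i : Fin n) :
    coordBasis he hu i = coordVec e u i := by
  refine (Module.Basis.map_apply _ _ _).trans ?_
  rw [OrthonormalBasis.coe_toBasis, EuclideanSpace.basisFun_apply]
  rfl

variable [RiemannianBundle (fun x : M ↦ TangentSpace (𝓡 n) x)]

theorem gram_eq_of_basis (he : e ∈ atlas (EuclideanSpace ℝ (Fin n)) M)
    {u : EuclideanSpace ℝ (Fin n)} (hu : u ∈ e.target) :
    gram e u = Matrix.of fun i j ↦ inner ℝ (coordBasis he hu i) (coordBasis he hu j) := by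
  ext i j
  simp [gram, coordBasis_apply]

theorem det_gram_pos (he : e ∈ atlas (EuclideanSpace ℝ (Fin n)) M)
    {u : EuclideanSpace ℝ (Fin n)} (hu : u ∈ e.target) : 0 < (gram e u).det := by
  rw [gram_eq_of_basis he hu]
  exact (Matrix.posDef_gram_of_linearIndependent (coordBasis he hu).linearIndependent).det_pos

theorem volDensity_pos (he : e ∈ atlas (EuclideanSpace ℝ (Fin n)) M)
    {u : EuclideanSpace ℝ (Fin n)} (hu : u ∈ e.target) : 0 < volDensity e u :=
  Real.sqrt_pos.2 (det_gram_pos he hu)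

theorem sum_orthonormalBasis_eq_sum_coordVec (he : e ∈ atlas (EuclideanSpace ℝ (Fin n)) M)
    {u : EuclideanSpace ℝ (Fin n)} (hu : u ∈ e.target) {κ : Type*} [Fintype κ]
    (E : OrthonormalBasis κ ℝ (TangentSpace (𝓡 n) (e.symm u)))
    (B : TangentSpace (𝓡 n) (e.symm u) →ₗ[ℝ] TangentSpace (𝓡 n) (e.symm u) →ₗ[ℝ] ℝ) :
    ∑ k, B (E k) (E k) =
      ∑ i, ∑ j, (gram e u)⁻¹ i j * B (coordVec e u i) (coordVec e u j) := by
  rw [sum_orthonormalBasis_eq_sum_gram_inv E (coordBasis he hu) B, gram_eq_of_basis he hu]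
  simp [coordBasis_apply]

variable [IsContMDiffRiemannianBundle (𝓡 n) ∞ (EuclideanSpace ℝ (Fin n))
      (fun x : M ↦ TangentSpace (𝓡 n) x)]

theorem contDiffOn_gram (he : e ∈ atlas (EuclideanSpace ℝ (Fin n)) M) (i j : Fin n) :
    ContDiffOn ℝ ∞ (fun u ↦ gram e u i j) e.target := by
  rw [← contMDiffOn_iff_contDiffOn]
  exact (contMDiffOn_coordVec he i).inner_bundle (contMDiffOn_coordVec he j)

theorem contDiffOn_det_gram (he : e ∈ atlas (EuclideanSpace ℝ (Fin n)) M) :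
    ContDiffOn ℝ ∞ (fun u ↦ (gram e u).det) e.target := by
  simp only [Matrix.det_apply]
  exact ContDiffOn.sum fun τ _ ↦ (contDiffOn_prod fun i _ ↦ contDiffOn_gram he _ _).const_smul _

theorem contDiffOn_volDensity (he : e ∈ atlas (EuclideanSpace ℝ (Fin n)) M) :
    ContDiffOn ℝ ∞ (volDensity e) e.target :=
  (contDiffOn_det_gram he).sqrt fun _ hu ↦ (det_gram_pos he hu).ne'

/-- Cramer's rule: the entries are polynomials in the `gram e u i j` divided by a determinant that
does not vanish. -/
theorem contDiffOn_gram_inv (he : e ∈ atlas (EuclideanSpace ℝ (Fin n)) M) (i j : Fin n) :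
    ContDiffOn ℝ ∞ (fun u ↦ (gram e u)⁻¹ i j) e.target := by
  simp only [Matrix.inv_def, Matrix.smul_apply, Ring.inverse_eq_inv', smul_eq_mul,
    Matrix.adjugate_apply, Matrix.det_apply]
  refine ContDiffOn.mul ?_ (ContDiffOn.sum fun τ _ ↦
    (contDiffOn_prod fun k _ ↦ ?_).const_smul _)
  · refine ContDiffOn.inv ?_ fun u hu ↦ ?_
    · simpa only [Matrix.det_apply] using contDiffOn_det_gram he
    · simpa only [Matrix.det_apply] using (det_gram_pos he hu).ne'
  · by_cases h : τ k = j
    · simp only [Matrix.updateRow_apply, h, if_true]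
      exact contDiffOn_const
    · simp only [Matrix.updateRow_apply, h, if_false]
      exact contDiffOn_gram he _ _

end Base

/-! ### Smooth sections along a map -/

section AlongMap

variable {B HB EB N HN EN : Type*} [NormedAddCommGroup EB] [NormedSpace ℝ EB]
  [TopologicalSpace HB] {IB : ModelWithCorners ℝ EB HB} [TopologicalSpace B] [ChartedSpace HB B]
  [NormedAddCommGroup EN] [NormedSpace ℝ EN]
  [TopologicalSpace HN] {IN : ModelWithCorners ℝ EN HN} [TopologicalSpace N] [ChartedSpace HN N]
  {F : Type*} [NormedAddCommGroup F] [NormedSpace ℝ F] {V : B → Type*}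
  [TopologicalSpace (TotalSpace F V)] [∀ x, AddCommGroup (V x)] [∀ x, Module ℝ (V x)]
  [∀ x, TopologicalSpace (V x)] [FiberBundle F V] [VectorBundle ℝ F V] {k : ℕ∞ω}
  {b : N → B} {x₀ : N}

/-- The sum of two smooth sections of a vector bundle along a map is smooth. -/
theorem contMDiffAt_add_along {v w : ∀ x, V (b x)}
    (hv : ContMDiffAt IN (IB.prod 𝓘(ℝ, F)) k (fun x ↦ TotalSpace.mk' F (b x) (v x)) x₀)
    (hw : ContMDiffAt IN (IB.prod 𝓘(ℝ, F)) k (fun x ↦ TotalSpace.mk' F (b x) (w x)) x₀) :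
    ContMDiffAt IN (IB.prod 𝓘(ℝ, F)) k (fun x ↦ TotalSpace.mk' F (b x) (v x + w x)) x₀ := by
  rw [contMDiffAt_totalSpace] at hv hw ⊢
  refine ⟨hv.1, (hv.2.add hw.2).congr_of_eventuallyEq ?_⟩
  have hb : ∀ᶠ x in nhds x₀, b x ∈ (trivializationAt F V (b x₀)).baseSet :=
    hv.1.continuousAt.eventually_mem ((trivializationAt F V (b x₀)).open_baseSet.mem_nhds
      (FiberBundle.mem_baseSet_trivializationAt' _))
  filter_upwards [hb] with x hx
  exact ((trivializationAt F V (b x₀)).linear ℝ hx).1 _ _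

/-- The product of a smooth function and a smooth section along a map is smooth. -/
theorem contMDiffAt_smul_along {f : N → ℝ} {v : ∀ x, V (b x)} (hf : ContMDiffAt IN 𝓘(ℝ, ℝ) k f x₀)
    (hv : ContMDiffAt IN (IB.prod 𝓘(ℝ, F)) k (fun x ↦ TotalSpace.mk' F (b x) (v x)) x₀) :
    ContMDiffAt IN (IB.prod 𝓘(ℝ, F)) k (fun x ↦ TotalSpace.mk' F (b x) (f x • v x)) x₀ := by
  rw [contMDiffAt_totalSpace] at hv ⊢
  refine ⟨hv.1, (hf.smul hv.2).congr_of_eventuallyEq ?_⟩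
  have hb : ∀ᶠ x in nhds x₀, b x ∈ (trivializationAt F V (b x₀)).baseSet :=
    hv.1.continuousAt.eventually_mem ((trivializationAt F V (b x₀)).open_baseSet.mem_nhds
      (FiberBundle.mem_baseSet_trivializationAt' _))
  filter_upwards [hb] with x hx
  exact ((trivializationAt F V (b x₀)).linear ℝ hx).2 _ _

/-- A finite sum of smooth sections along a map is smooth. -/
theorem contMDiffAt_sum_along {ι : Type*} (t : Finset ι) {v : ι → ∀ x, V (b x)}
    (hb : ContMDiffAt IN IB k b x₀)
    (hv : ∀ i ∈ t,
      ContMDiffAt IN (IB.prod 𝓘(ℝ, F)) k (fun x ↦ TotalSpace.mk' F (b x) (v i x)) x₀) :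
    ContMDiffAt IN (IB.prod 𝓘(ℝ, F)) k (fun x ↦ TotalSpace.mk' F (b x) (∑ i ∈ t, v i x)) x₀ := by
  classical
  induction t using Finset.induction_on with
  | empty =>
    simp only [Finset.sum_empty]
    exact ((contMDiff_zeroSection ℝ V).contMDiffAt (x := b x₀)).comp x₀ hb
  | insert i t hi ih =>
    simp only [Finset.sum_insert hi]
    exact contMDiffAt_add_along (hv i (Finset.mem_insert_self i t))
      (ih fun j hj ↦ hv j (Finset.mem_insert_of_mem hj))

end AlongMap

/-! ### Global sections forming a local frame -/

section Frame

variable {n : ℕ} {M : Type*} [TopologicalSpace M] [T2Space M]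
  [ChartedSpace (EuclideanSpace ℝ (Fin n)) M] [IsManifold (𝓡 n) ∞ M]
  {F : Type*} [NormedAddCommGroup F] [NormedSpace ℝ F] [FiniteDimensional ℝ F]
  {V : M → Type*} [TopologicalSpace (TotalSpace F V)]
  [∀ x, NormedAddCommGroup (V x)] [∀ x, InnerProductSpace ℝ (V x)]
  [FiberBundle F V] [VectorBundle ℝ F V] [ContMDiffVectorBundle ∞ F V (𝓡 n)]

/-- Near each point there are global smooth sections which form a frame, and the coefficients in
this frame of a smooth family of sections depend smoothly on all variables. -/
theorem exists_smooth_frame (x₀ : M) (s : ℝ → ∀ x, V x)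
    (hs : ContMDiff ((𝓡 n).prod 𝓘(ℝ, ℝ)) ((𝓡 n).prod 𝓘(ℝ, F)) ∞
      (fun z : M × ℝ ↦ TotalSpace.mk' F z.1 (s z.2 z.1))) :
    ∃ (m : ℕ) (S : Fin m → ∀ x, V x) (c : Fin m → M × ℝ → ℝ) (U : Set M),
      IsOpen U ∧ x₀ ∈ U ∧
      (∀ a, ContMDiff (𝓡 n) ((𝓡 n).prod 𝓘(ℝ, F)) ∞ (fun x ↦ TotalSpace.mk' F x (S a x))) ∧
      (∀ a, ∀ z : M × ℝ, z.1 ∈ U → ContMDiffAt ((𝓡 n).prod 𝓘(ℝ, ℝ)) 𝓘(ℝ, ℝ) ∞ (c a) z) ∧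
      ∀ x ∈ U, ∀ t, s t x = ∑ a, c a (x, t) • S a x := by
  let e := trivializationAt F V x₀
  let b := Module.finBasis ℝ F
  have hx₀ : x₀ ∈ e.baseSet := FiberBundle.mem_baseSet_trivializationAt' x₀
  -- Multiplying the local frame by a bump function supported in the base set extends it by zero to
  -- global sections, to which `cov` applies; where `f = 1` nothing changes.
  obtain ⟨f, hf⟩ : ∃ f : SmoothBumpFunction (𝓡 n) x₀, tsupport f ⊆ e.baseSet := by
    obtain ⟨f, -, hf⟩ := (SmoothBumpFunction.nhds_basis_tsupport (I := 𝓡 n) x₀).mem_iff.1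
      (e.open_baseSet.mem_nhds hx₀)
    exact ⟨f, hf⟩
  obtain ⟨U, hU, hUo, hxU⟩ := mem_nhds_iff.1
    (Filter.inter_mem f.eventuallyEq_one (e.open_baseSet.mem_nhds hx₀))
  refine ⟨_, fun a ↦ (f : M → ℝ) • e.localFrame b a, fun a z ↦ b.repr (e ⟨z.1, s z.2 z.1⟩).2 a, U,
    hUo, hxU, fun a ↦ ?_, fun a z hz ↦ ?_, fun x hx t ↦ ?_⟩
  · exact ContMDiffOn.smul_section_of_tsupport f.contMDiff.contMDiffOn e.open_baseSet hf
      (e.contMDiffOn_localFrame_baseSet ∞ b a)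
  · let L : F →L[ℝ] ℝ := LinearMap.toContinuousLinearMap (b.coord a)
    have h1 : ContMDiffAt ((𝓡 n).prod 𝓘(ℝ, ℝ)) 𝓘(ℝ, F) ∞
        (fun z : M × ℝ ↦ (e ⟨z.1, s z.2 z.1⟩).2) z :=
      ((e.contMDiffAt_iff (f := fun z : M × ℝ ↦ TotalSpace.mk' F z.1 (s z.2 z.1))
        (by simpa [e.mem_source] using (hU hz).2)).1 (hs z)).2
    exact L.contDiff.contMDiff.contMDiffAt.comp z h1
  · have hxe := (hU hx).2
    have h1 : f x = 1 := (hU hx).1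
    rw [e.eq_sum_localFrameCoeff_smul (I := 𝓡 n) (b := b) (s := s t) hxe]
    refine Finset.sum_congr rfl fun a _ ↦ ?_
    rw [e.localFrameCoeff_eq_coeff (I := 𝓡 n) hxe]
    simp [h1]

end Frame

/-! ### The vertical metric as a bilinear form -/

section VerticalMetric

variable {W : Type*} [NormedAddCommGroup W] [InnerProductSpace ℝ W]

/-- The vertical metric as a bilinear map. -/
noncomputable def verticalMetricBilin (p q : ℝ) (e : W) : W →ₗ[ℝ] W →ₗ[ℝ] ℝ :=
  LinearMap.mk₂ ℝ (verticalMetric p q e)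
    (fun a b c ↦ by simp only [verticalMetric, inner_add_left]; ring)
    (fun r a b ↦ by simp only [verticalMetric, inner_smul_left, smul_eq_mul, conj_trivial]; ring)
    (fun a b c ↦ by simp only [verticalMetric, inner_add_right, inner_add_left]; ring)
    (fun r a b ↦ by
      simp only [verticalMetric, inner_smul_right, inner_smul_left, smul_eq_mul, conj_trivial]
      ring)

end VerticalMetric

/-! ### The energy density and the connection in coordinates -/

section Density

variable {n : ℕ} {M : Type*} [TopologicalSpace M]
  [ChartedSpace (EuclideanSpace ℝ (Fin n)) M] [IsManifold (𝓡 n) ∞ M]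
  {F : Type*} [NormedAddCommGroup F] [NormedSpace ℝ F]
  {V : M → Type*} [TopologicalSpace (TotalSpace F V)]
  [∀ x, NormedAddCommGroup (V x)] [∀ x, InnerProductSpace ℝ (V x)]
  [FiberBundle F V]
  {e : OpenPartialHomeomorph M (EuclideanSpace ℝ (Fin n))}

theorem contMDiffAt_chart_symm_prod (he : e ∈ atlas (EuclideanSpace ℝ (Fin n)) M)
    {u : EuclideanSpace ℝ (Fin n)} (hu : u ∈ e.target) (t : ℝ) :
    ContMDiffAt 𝓘(ℝ, EuclideanSpace ℝ (Fin n) × ℝ) ((𝓡 n).prod 𝓘(ℝ, ℝ)) ∞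
      (fun z : EuclideanSpace ℝ (Fin n) × ℝ ↦ (e.symm z.1, z.2)) (u, t) :=
  ((contMDiffAt_chart_symm he hu).comp (u, t) contDiff_fst.contMDiff.contMDiffAt).prodMk
    contDiff_snd.contMDiff.contMDiffAt

theorem mvfderiv_coordVec (he : e ∈ atlas (EuclideanSpace ℝ (Fin n)) M)
    {u : EuclideanSpace ℝ (Fin n)} (hu : u ∈ e.target) {f : M → ℝ}
    (hf : MDifferentiableAt (𝓡 n) 𝓘(ℝ, ℝ) f (e.symm u)) (i : Fin n) :
    mvfderiv (𝓡 n) f (e.symm u) (coordVec e u i) = partialDeriv i (f ∘ e.symm) u := by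
  have h := mfderiv_comp u hf ((contMDiffAt_chart_symm he hu).mdifferentiableAt (by simp))
  rw [mfderiv_eq_fderiv] at h
  rw [partialDeriv, h]
  rfl

section Riemannian

variable [RiemannianBundle (fun x : M ↦ TangentSpace (𝓡 n) x)]

/-- The orthonormal bases in `verticalDensity` are chosen point by point, with no regularity in the
point. The trace in coordinate vectors involves only smooth data. -/
theorem verticalDensity_symm (cov : CovariantDerivative (𝓡 n) F V)
    (he : e ∈ atlas (EuclideanSpace ℝ (Fin n)) M)
    {u : EuclideanSpace ℝ (Fin n)} (hu : u ∈ e.target) (p q : ℝ) (σ : ∀ x, V x) :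
    verticalDensity cov p q σ (e.symm u) = ∑ i, ∑ j, (gram e u)⁻¹ i j *
      verticalMetric p q (σ (e.symm u)) (cov σ (e.symm u) (coordVec e u i))
        (cov σ (e.symm u) (coordVec e u j)) := by
  have : FiniteDimensional ℝ (TangentSpace (𝓡 n) (e.symm u)) :=
    inferInstanceAs (FiniteDimensional ℝ (EuclideanSpace ℝ (Fin n)))
  let L : TangentSpace (𝓡 n) (e.symm u) →ₗ[ℝ] V (e.symm u) := (cov σ (e.symm u)).toLinearMap
  exact sum_orthonormalBasis_eq_sum_coordVec he hu (stdOrthonormalBasis ℝ _)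
    ((verticalMetricBilin p q (σ (e.symm u))).compl₁₂ L L)

end Riemannian

variable [VectorBundle ℝ F V]

/-- An iterated Leibniz rule. Differentiability of the partial sums is carried through the induction
because additivity of `cov` requires it. -/
theorem covariantDerivative_sum_smul (cov : CovariantDerivative (𝓡 n) F V) {ι : Type*}
    (t : Finset ι) (g : ι → M → ℝ) (S : ι → ∀ x, V x) (x : M)
    (hg : ∀ a ∈ t, MDifferentiableAt (𝓡 n) 𝓘(ℝ, ℝ) (g a) x)
    (hS : ∀ a ∈ t, MDifferentiableAt (𝓡 n) ((𝓡 n).prod 𝓘(ℝ, F))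
      (fun y ↦ TotalSpace.mk' F y (S a y)) x) :
    MDifferentiableAt (𝓡 n) ((𝓡 n).prod 𝓘(ℝ, F))
      (fun y ↦ TotalSpace.mk' F y ((∑ a ∈ t, g a • S a) y)) x ∧
    cov (∑ a ∈ t, g a • S a) x =
      ∑ a ∈ t, (g a x • cov (S a) x + (mvfderiv (𝓡 n) (g a) x).smulRight (S a x)) := by
  classical
  induction t using Finset.induction_on with
  | empty =>
    simp only [Finset.sum_empty, CovariantDerivative.zero, Pi.zero_apply, and_true]
    exact mdifferentiableAt_zeroSection ..
  | insert i t hi ih =>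
    have h := ih (fun a ha ↦ hg a (Finset.mem_insert_of_mem ha))
      (fun a ha ↦ hS a (Finset.mem_insert_of_mem ha))
    have hgi := hg i (Finset.mem_insert_self i t)
    have hSi := hS i (Finset.mem_insert_self i t)
    rw [Finset.sum_insert hi, Finset.sum_insert hi]
    refine ⟨mdifferentiableAt_add_section (hgi.smul_section hSi) h.1, ?_⟩
    rw [cov.isCovariantDerivativeOnUniv.add (hgi.smul_section hSi) h.1,
      cov.isCovariantDerivativeOnUniv.leibniz hSi hgi, h.2]

end Density

/-! ### Joint smoothness of the energy density -/

section Smoothness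

variable {n : ℕ} {M : Type*} [TopologicalSpace M] [T2Space M]
  [ChartedSpace (EuclideanSpace ℝ (Fin n)) M] [IsManifold (𝓡 n) ∞ M]
  {F : Type*} [NormedAddCommGroup F] [NormedSpace ℝ F] [FiniteDimensional ℝ F]
  {V : M → Type*} [TopologicalSpace (TotalSpace F V)]
  [∀ x, NormedAddCommGroup (V x)] [∀ x, InnerProductSpace ℝ (V x)]
  [FiberBundle F V] [VectorBundle ℝ F V] [ContMDiffVectorBundle ∞ F V (𝓡 n)]
  {e : OpenPartialHomeomorph M (EuclideanSpace ℝ (Fin n))}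

/-- In a frame `S a` independent of `t`, `∇_{∂ᵢ} s_t = ∑ₐ (cₐ ∇_{∂ᵢ} Sₐ + (∂ᵢ cₐ) Sₐ)`, and each
term is smooth in `(u, t)`. -/
theorem contMDiffAt_cov_coordVec (cov : CovariantDerivative (𝓡 n) F V)
    (hcov : CovariantDerivative.ContMDiffCovariantDerivative cov ∞)
    (he : e ∈ atlas (EuclideanSpace ℝ (Fin n)) M)
    {u : EuclideanSpace ℝ (Fin n)} (hu : u ∈ e.target) (t : ℝ) (s : ℝ → ∀ x, V x)
    (hs : ContMDiff ((𝓡 n).prod 𝓘(ℝ, ℝ)) ((𝓡 n).prod 𝓘(ℝ, F)) ∞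
      (fun z : M × ℝ ↦ TotalSpace.mk' F z.1 (s z.2 z.1))) (i : Fin n) :
    ContMDiffAt 𝓘(ℝ, EuclideanSpace ℝ (Fin n) × ℝ) ((𝓡 n).prod 𝓘(ℝ, F)) ∞
      (fun z : EuclideanSpace ℝ (Fin n) × ℝ ↦ TotalSpace.mk' F (e.symm z.1)
        (cov (s z.2) (e.symm z.1) (coordVec e z.1 i))) (u, t) := by
  obtain ⟨m, S, c, U, hUo, hxU, hS, hc, hsum⟩ := exists_smooth_frame (e.symm u) s hs
  have hfst : ContMDiff 𝓘(ℝ, EuclideanSpace ℝ (Fin n) × ℝ) (𝓡 n) ∞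
    (Prod.fst : EuclideanSpace ℝ (Fin n) × ℝ → _) := contDiff_fst.contMDiff
  have hb : ContMDiffAt 𝓘(ℝ, EuclideanSpace ℝ (Fin n) × ℝ) (𝓡 n) ∞
      (fun z : EuclideanSpace ℝ (Fin n) × ℝ ↦ e.symm z.1) (u, t) :=
    (contMDiffAt_chart_symm he hu).comp (u, t) hfst.contMDiffAt
  have hcoord : ContMDiffAt 𝓘(ℝ, EuclideanSpace ℝ (Fin n) × ℝ)
      ((𝓡 n).prod 𝓘(ℝ, EuclideanSpace ℝ (Fin n))) ∞
      (fun z : EuclideanSpace ℝ (Fin n) × ℝ ↦ TotalSpace.mk' (EuclideanSpace ℝ (Fin n))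
        (E := TangentSpace (𝓡 n)) (e.symm z.1) (coordVec e z.1 i)) (u, t) :=
    ((contMDiffOn_coordVec he i).contMDiffAt (e.open_target.mem_nhds hu)).comp (u, t)
      hfst.contMDiffAt
  have hchat (a : Fin m) (z : EuclideanSpace ℝ (Fin n) × ℝ) (hz : z.1 ∈ e.target)
      (hzU : e.symm z.1 ∈ U) :
      ContDiffAt ℝ ∞ (fun z : EuclideanSpace ℝ (Fin n) × ℝ ↦ c a (e.symm z.1, z.2)) z :=
    contMDiffAt_iff_contDiffAt.1
      ((hc a (e.symm z.1, z.2) hzU).comp z (contMDiffAt_chart_symm_prod he hz z.2))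
  have hmain : ContMDiffAt 𝓘(ℝ, EuclideanSpace ℝ (Fin n) × ℝ) ((𝓡 n).prod 𝓘(ℝ, F)) ∞
      (fun z : EuclideanSpace ℝ (Fin n) × ℝ ↦ TotalSpace.mk' F (e.symm z.1)
        (∑ a, (c a (e.symm z.1, z.2) • cov (S a) (e.symm z.1) (coordVec e z.1 i) +
          (fderiv ℝ (fun z : EuclideanSpace ℝ (Fin n) × ℝ ↦ c a (e.symm z.1, z.2)) z
            (EuclideanSpace.single i (1 : ℝ), 0)) • S a (e.symm z.1)))) (u, t) := by
    refine contMDiffAt_sum_along _ hb fun a _ ↦ contMDiffAt_add_along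
      (contMDiffAt_smul_along ?_ ?_) (contMDiffAt_smul_along ?_ ?_)
    · exact (hchat a (u, t) hu hxU).contMDiffAt
    · have h1 := (hcov.contMDiff.contMDiff (σ := S a) ((hS a).contMDiffOn)).contMDiffAt
        (x := e.symm u) Filter.univ_mem
      exact ContMDiffAt.clm_bundle_apply (E₁ := fun x : M ↦ TangentSpace (𝓡 n) x)
        (h1.comp (u, t) hb) hcoord
    · exact (((hchat a (u, t) hu hxU).fderiv_right (m := ∞) le_rfl).clm_apply
        contDiffAt_const).contMDiffAt
    · exact (hS a).contMDiffAt.comp (u, t) hb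
  refine hmain.congr_of_eventuallyEq ?_
  have h1 : ∀ᶠ z : EuclideanSpace ℝ (Fin n) × ℝ in nhds (u, t), z.1 ∈ e.target :=
    continuousAt_fst.eventually_mem (e.open_target.mem_nhds hu)
  have h2 : ∀ᶠ z : EuclideanSpace ℝ (Fin n) × ℝ in nhds (u, t), e.symm z.1 ∈ U :=
    hb.continuousAt.eventually_mem (hUo.mem_nhds hxU)
  filter_upwards [h1, h2] with z hz hzU
  have hcM (a : Fin m) : MDifferentiableAt (𝓡 n) 𝓘(ℝ, ℝ) (fun x ↦ c a (x, z.2)) (e.symm z.1) :=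
    ((hc a (e.symm z.1, z.2) hzU).comp (e.symm z.1)
      (contMDiffAt_id.prodMk contMDiffAt_const)).mdifferentiableAt (by simp)
  have hkey := covariantDerivative_sum_smul cov Finset.univ (fun a x ↦ c a (x, z.2)) S (e.symm z.1)
    (fun a _ ↦ hcM a) (fun a _ ↦ (hS a).mdifferentiableAt (by simp))
  have hst : MDifferentiableAt (𝓡 n) ((𝓡 n).prod 𝓘(ℝ, F))
      (fun y ↦ TotalSpace.mk' F y (s z.2 y)) (e.symm z.1) :=
    ((hs (e.symm z.1, z.2)).comp (e.symm z.1)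
      (contMDiffAt_id.prodMk contMDiffAt_const)).mdifferentiableAt (by simp)
  -- The frame expansion holds on `U` only; this suffices since a connection is a local operator.
  have hcongr := cov.isCovariantDerivativeOnUniv.congr_of_eventuallyEq hst hkey.1 Filter.univ_mem
    (Filter.eventually_of_mem (hUo.mem_nhds hzU) fun x hx ↦ by
      simpa [Finset.sum_apply] using hsum x hx z.2)
  congr 1
  rw [hcongr, hkey.2]
  rw [sum_apply]
  refine Finset.sum_congr rfl fun a _ ↦ ?_
  rw [add_apply, smul_apply,
    ContinuousLinearMap.smulRight_apply, mvfderiv_coordVec he hz (hcM a)]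
  congr 2
  -- The partial derivative at frozen time is the total derivative in the direction `(∂ᵢ, 0)`.
  have hd := ((hchat a z hz hzU).differentiableAt (by simp)).hasFDerivAt
  have hin : HasFDerivAt (fun v : EuclideanSpace ℝ (Fin n) ↦ (v, z.2))
      (ContinuousLinearMap.inl ℝ (EuclideanSpace ℝ (Fin n)) ℝ) z.1 :=
    hasFDerivAt_prodMk_left z.1 z.2
  have := (HasFDerivAt.comp (g := fun z : EuclideanSpace ℝ (Fin n) × ℝ ↦ c a (e.symm z.1, z.2))
    z.1 hd hin).fderiv
  rw [partialDeriv]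
  refine (congr($this (EuclideanSpace.single i (1 : ℝ)))).trans ?_
  simp

variable [RiemannianBundle (fun x : M ↦ TangentSpace (𝓡 n) x)]
  [IsContMDiffRiemannianBundle (𝓡 n) ∞ (EuclideanSpace ℝ (Fin n))
      (fun x : M ↦ TangentSpace (𝓡 n) x)]
  [IsContMDiffRiemannianBundle (𝓡 n) ∞ F V]

/-- The vertical energy density of a smooth family of sections is smooth in all variables. -/
theorem contDiffAt_verticalDensity (cov : CovariantDerivative (𝓡 n) F V)
    (hcov : CovariantDerivative.ContMDiffCovariantDerivative cov ∞)
    (he : e ∈ atlas (EuclideanSpace ℝ (Fin n)) M)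
    {u : EuclideanSpace ℝ (Fin n)} (hu : u ∈ e.target) (t : ℝ) (p q : ℝ) (s : ℝ → ∀ x, V x)
    (hs : ContMDiff ((𝓡 n).prod 𝓘(ℝ, ℝ)) ((𝓡 n).prod 𝓘(ℝ, F)) ∞
      (fun z : M × ℝ ↦ TotalSpace.mk' F z.1 (s z.2 z.1))) :
    ContDiffAt ℝ ∞ (fun z : EuclideanSpace ℝ (Fin n) × ℝ ↦
      verticalDensity cov p q (s z.2) (e.symm z.1)) (u, t) := by
  have hT (i : Fin n) := contMDiffAt_cov_coordVec cov hcov he hu t s hs i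
  have hs' : ContMDiffAt 𝓘(ℝ, EuclideanSpace ℝ (Fin n) × ℝ) ((𝓡 n).prod 𝓘(ℝ, F)) ∞
      (fun z : EuclideanSpace ℝ (Fin n) × ℝ ↦ TotalSpace.mk' F (e.symm z.1)
        (s z.2 (e.symm z.1))) (u, t) :=
    (hs (e.symm u, t)).comp (u, t) (contMDiffAt_chart_symm_prod he hu t)
  have hTT (i j : Fin n) := contMDiffAt_iff_contDiffAt.1 ((hT i).inner_bundle (hT j))
  have hTs (i : Fin n) := contMDiffAt_iff_contDiffAt.1 ((hT i).inner_bundle hs')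
  have hss := contMDiffAt_iff_contDiffAt.1 (hs'.inner_bundle hs')
  simp only [real_inner_self_eq_norm_sq] at hss
  have hw : ContDiffAt ℝ ∞ (fun z : EuclideanSpace ℝ (Fin n) × ℝ ↦
      (1 / (1 + ‖s z.2 (e.symm z.1)‖ ^ 2)) ^ p) (u, t) :=
    (contDiffAt_const.div (contDiffAt_const.add hss) (by positivity)).rpow_const_of_ne
      (one_div_pos.2 (by positivity)).ne'
  have hg (i j : Fin n) : ContDiffAt ℝ ∞ (fun z : EuclideanSpace ℝ (Fin n) × ℝ ↦
      (gram e z.1)⁻¹ i j) (u, t) :=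
    ((contDiffOn_gram_inv he i j).contDiffAt (e.open_target.mem_nhds hu)).comp (u, t)
      contDiffAt_fst
  have hmain : ContDiffAt ℝ ∞ (fun z : EuclideanSpace ℝ (Fin n) × ℝ ↦
      ∑ i, ∑ j, (gram e z.1)⁻¹ i j *
      verticalMetric p q (s z.2 (e.symm z.1)) (cov (s z.2) (e.symm z.1) (coordVec e z.1 i))
        (cov (s z.2) (e.symm z.1) (coordVec e z.1 j))) (u, t) := by
    refine ContDiffAt.sum fun i _ ↦ ContDiffAt.sum fun j _ ↦ (hg i j).mul ?_
    exact hw.mul ((hTT i j).add ((contDiffAt_const.mul (hTs i)).mul (hTs j)))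
  refine hmain.congr_of_eventuallyEq ?_
  filter_upwards [continuousAt_fst.eventually_mem (e.open_target.mem_nhds hu)] with z hz
  exact verticalDensity_symm cov he hz p q (s z.2)

end Smoothness

/-! ### Topology and measurability of charts -/

section Charts

variable {n : ℕ} {M : Type*} [TopologicalSpace M]
  {e : OpenPartialHomeomorph M (EuclideanSpace ℝ (Fin n))}

theorem chart_symm_preimage_inter_target {K : Set M} (hKe : K ⊆ e.source) :
    e.symm ⁻¹' K ∩ e.target = e '' K := by
  rw [Set.inter_comm]
  exact (e.image_eq_target_inter_inv_preimage hKe).symm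

theorem isCompact_chart_image {K : Set M} (hK : IsCompact K) (hKe : K ⊆ e.source) :
    IsCompact (e '' K) := hK.image_of_continuousOn (e.continuousOn.mono hKe)

theorem chart_image_subset_target {K : Set M} (hKe : K ⊆ e.source) : e '' K ⊆ e.target := by
  rintro _ ⟨x, hx, rfl⟩
  exact e.map_source (hKe hx)

variable [MeasurableSpace M] [BorelSpace M]

theorem aemeasurable_chart_symm (e : OpenPartialHomeomorph M (EuclideanSpace ℝ (Fin n)))
    (f : EuclideanSpace ℝ (Fin n) → ENNReal) :
    AEMeasurable e.symm ((volume.restrict e.target).withDensity f) :=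
  (e.continuousOn_symm.aemeasurable e.open_target.measurableSet).mono_ac
    (withDensity_absolutelyContinuous _ _)

theorem measurableSet_chart_symm_preimage
    (e : OpenPartialHomeomorph M (EuclideanSpace ℝ (Fin n))) {A : Set M} (hA : MeasurableSet A) :
    MeasurableSet (e.symm ⁻¹' A ∩ e.target) := by
  have h := e.continuousOn_symm.domRestrict.measurable hA
  have h' := (MeasurableEmbedding.subtype_coe e.open_target.measurableSet).measurableSet_image.2 h
  convert h' using 1
  ext u
  simp [and_comm]

end Charts

/-! ### The Riemannian volume in charts -/

section Volume

variable {n : ℕ} {M : Type*} [TopologicalSpace M]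
  [ChartedSpace (EuclideanSpace ℝ (Fin n)) M] [IsManifold (𝓡 n) ∞ M]
  {e e' : OpenPartialHomeomorph M (EuclideanSpace ℝ (Fin n))}

theorem hasFDerivAt_transition (he : e ∈ atlas (EuclideanSpace ℝ (Fin n)) M)
    (he' : e' ∈ atlas (EuclideanSpace ℝ (Fin n)) M) {u : EuclideanSpace ℝ (Fin n)}
    (hu : u ∈ e.target) (hu' : e.symm u ∈ e'.source) :
    HasFDerivAt (e' ∘ e.symm) (fderiv ℝ (e' ∘ e.symm) u) u := by
  have h : ContMDiffAt (𝓡 n) (𝓡 n) ∞ (e' ∘ e.symm) u :=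
    ((contMDiffOn_chart he').contMDiffAt (e'.open_source.mem_nhds hu')).comp u
      (contMDiffAt_chart_symm he hu)
  exact ((contMDiffAt_iff_contDiffAt.1 h).differentiableAt (by simp)).hasFDerivAt

variable [RiemannianBundle (fun x : M ↦ TangentSpace (𝓡 n) x)]

/-- The metric at a point of the manifold, as a function on the model vector space. -/
noncomputable def modelInner (x : M) (v w : EuclideanSpace ℝ (Fin n)) : ℝ :=
  @inner ℝ (TangentSpace (𝓡 n) x) _ v w

/-- The coordinate vector `∂ᵢ` of a chart, as an element of the model vector space. -/
noncomputable def modelCoordVec (e : OpenPartialHomeomorph M (EuclideanSpace ℝ (Fin n)))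
    (u : EuclideanSpace ℝ (Fin n)) (i : Fin n) : EuclideanSpace ℝ (Fin n) :=
  coordVec e u i

theorem gram_eq_modelInner (e : OpenPartialHomeomorph M (EuclideanSpace ℝ (Fin n)))
    (u : EuclideanSpace ℝ (Fin n)) (i j : Fin n) :
    gram e u i j = modelInner (e.symm u) (modelCoordVec e u i) (modelCoordVec e u j) := rfl

theorem modelInner_sum_sum (x : M) (a b : Fin n → ℝ) (v : Fin n → EuclideanSpace ℝ (Fin n)) :
    modelInner x (∑ k, a k • v k) (∑ l, b l • v l) =
      ∑ k, ∑ l, a k * b l * modelInner x (v k) (v l) := by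
  let v' : Fin n → TangentSpace (𝓡 n) x := v
  have : (inner ℝ (∑ k, a k • v' k) (∑ l, b l • v' l) : ℝ) =
      ∑ k, ∑ l, a k * b l * inner ℝ (v' k) (v' l) := by
    rw [sum_inner]
    refine Finset.sum_congr rfl fun k _ ↦ ?_
    rw [inner_sum]
    refine Finset.sum_congr rfl fun l _ ↦ ?_
    rw [inner_smul_left, inner_smul_right, conj_trivial, mul_assoc]
  exact this

/-- The chain rule for `e.symm = e'.symm ∘ (e' ∘ e.symm)`. The base points `e.symm u` and `e'.symm
(e' (e.symm u))` are only propositionally equal, so the vectors are compared in the model space. -/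
theorem modelCoordVec_eq_sum (he : e ∈ atlas (EuclideanSpace ℝ (Fin n)) M)
    (he' : e' ∈ atlas (EuclideanSpace ℝ (Fin n)) M) {u : EuclideanSpace ℝ (Fin n)}
    (hu : u ∈ e.target) (hu' : e.symm u ∈ e'.source) (i : Fin n) :
    modelCoordVec e u i =
      ∑ k, (fderiv ℝ (e' ∘ e.symm) u (EuclideanSpace.single i (1 : ℝ))) k •
        modelCoordVec e' (e' (e.symm u)) k := by
  have hψ := (hasFDerivAt_transition he he' hu hu').differentiableAt.mdifferentiableAt
  have hs : MDifferentiableAt (𝓡 n) (𝓡 n) e'.symm ((e' ∘ e.symm) u) :=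
    (contMDiffAt_chart_symm he' (e'.map_source hu')).mdifferentiableAt (by simp)
  have heq : (e.symm : EuclideanSpace ℝ (Fin n) → M) =ᶠ[nhds u] e'.symm ∘ (e' ∘ e.symm) := by
    filter_upwards [(e.continuousAt_symm hu).eventually_mem (e'.open_source.mem_nhds hu')] with v hv
    exact (e'.left_inv hv).symm
  let A' : EuclideanSpace ℝ (Fin n) →L[ℝ] EuclideanSpace ℝ (Fin n) :=
    mfderiv (𝓡 n) (𝓡 n) e'.symm ((e' ∘ e.symm) u)
  have h1 : modelCoordVec e u i =
      A' (fderiv ℝ (e' ∘ e.symm) u (EuclideanSpace.single i (1 : ℝ))) := by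
    have h2 := mfderiv_comp u hs hψ
    rw [mfderiv_eq_fderiv] at h2
    exact congr($(heq.mfderiv_eq.trans h2) (EuclideanSpace.single i (1 : ℝ)))
  rw [h1]
  conv_lhs => rw [← (EuclideanSpace.basisFun (Fin n) ℝ).sum_repr
    (fderiv ℝ (e' ∘ e.symm) u (EuclideanSpace.single i (1 : ℝ)))]
  rw [map_sum]
  refine Finset.sum_congr rfl fun k _ ↦ ?_
  rw [map_smul, EuclideanSpace.basisFun_apply, EuclideanSpace.basisFun_repr]
  rfl

/-- The Gram matrices are related by `G = Jᵀ G' J` with `J` the Jacobian matrix, so the determinant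
picks up the factor `(det J)²`. -/
theorem volDensity_transition (he : e ∈ atlas (EuclideanSpace ℝ (Fin n)) M)
    (he' : e' ∈ atlas (EuclideanSpace ℝ (Fin n)) M) {u : EuclideanSpace ℝ (Fin n)}
    (hu : u ∈ e.target) (hu' : e.symm u ∈ e'.source) :
    volDensity e u = |(fderiv ℝ (e' ∘ e.symm) u).det| * volDensity e' (e' (e.symm u)) := by
  set b := (EuclideanSpace.basisFun (Fin n) ℝ).toBasis
  set J : Matrix (Fin n) (Fin n) ℝ := LinearMap.toMatrix b b
    (fderiv ℝ (e' ∘ e.symm) u : EuclideanSpace ℝ (Fin n) →ₗ[ℝ] EuclideanSpace ℝ (Fin n)) with hJ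
  have hJdet : J.det = (fderiv ℝ (e' ∘ e.symm) u).det := LinearMap.det_toMatrix b _
  have hJapp (k i : Fin n) :
      J k i = (fderiv ℝ (e' ∘ e.symm) u (EuclideanSpace.single i (1 : ℝ))) k := by
    simp [hJ, b, LinearMap.toMatrix_apply]
  have hgram : gram e u = J.transpose * gram e' (e' (e.symm u)) * J := by
    ext i j
    rw [gram_eq_modelInner, modelCoordVec_eq_sum he he' hu hu' i, modelCoordVec_eq_sum he he' hu hu' j,
      modelInner_sum_sum]
    simp only [← hJapp, Matrix.mul_apply, Matrix.transpose_apply, Finset.sum_mul]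
    rw [Finset.sum_comm]
    refine Finset.sum_congr rfl fun l _ ↦ Finset.sum_congr rfl fun k _ ↦ ?_
    rw [gram_eq_modelInner, e'.left_inv hu']
    ring
  rw [volDensity, hgram, Matrix.det_mul, Matrix.det_mul, Matrix.det_transpose, ← hJdet, volDensity,
    show J.det * (gram e' (e' (e.symm u))).det * J.det =
      J.det ^ 2 * (gram e' (e' (e.symm u))).det by ring, Real.sqrt_mul (sq_nonneg _),
    Real.sqrt_sq_eq_abs]

variable [MeasurableSpace M] [BorelSpace M]

theorem chartVolume_restrict (e : OpenPartialHomeomorph M (EuclideanSpace ℝ (Fin n))) {A : Set M}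
    (hA : MeasurableSet A) :
    (chartVolume e).restrict A = ((volume.restrict (e.symm ⁻¹' A ∩ e.target)).withDensity
      fun u ↦ ENNReal.ofReal (volDensity e u)).map e.symm := by
  rw [chartVolume, Measure.restrict_map_of_aemeasurable (aemeasurable_chart_symm e _) hA,
    restrict_withDensity', Measure.restrict_restrict' e.open_target.measurableSet]

theorem chartVolume_apply (e : OpenPartialHomeomorph M (EuclideanSpace ℝ (Fin n))) {A : Set M}
    (hA : MeasurableSet A) :
    chartVolume e A =
      ∫⁻ u in e.symm ⁻¹' A ∩ e.target, ENNReal.ofReal (volDensity e u) := by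
  rw [chartVolume, Measure.map_apply_of_aemeasurable (aemeasurable_chart_symm e _) hA,
    withDensity_apply', Measure.restrict_restrict' e.open_target.measurableSet]

/-- The change of variables formula: the volumes in two charts agree on their overlap. -/
theorem chartVolume_eq_of_subset (he : e ∈ atlas (EuclideanSpace ℝ (Fin n)) M)
    (he' : e' ∈ atlas (EuclideanSpace ℝ (Fin n)) M) {A : Set M} (hA : MeasurableSet A)
    (hAe : A ⊆ e.source) (hAe' : A ⊆ e'.source) : chartVolume e A = chartVolume e' A := by
  rw [chartVolume_apply e hA, chartVolume_apply e' hA]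
  have himage : e'.symm ⁻¹' A ∩ e'.target = (e' ∘ e.symm) '' (e.symm ⁻¹' A ∩ e.target) := by
    ext v
    constructor
    · rintro ⟨hv, hvt⟩
      refine ⟨e (e'.symm v), ⟨?_, e.map_source (hAe hv)⟩, ?_⟩
      · simpa [e.left_inv (hAe hv)] using hv
      · simp [e.left_inv (hAe hv), e'.right_inv hvt]
    · rintro ⟨u, ⟨hu, hut⟩, rfl⟩
      refine ⟨?_, e'.map_source (hAe' hu)⟩
      simpa [e'.left_inv (hAe' hu)] using hu
  have hinj : Set.InjOn (e' ∘ e.symm) (e.symm ⁻¹' A ∩ e.target) := fun u hu v hv huv ↦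
    e.symm.injOn hu.2 hv.2 (e'.injOn (hAe' hu.1) (hAe' hv.1) huv)
  rw [himage, lintegral_image_eq_lintegral_abs_det_fderiv_mul volume
    (measurableSet_chart_symm_preimage e hA)
    (fun u hu ↦ (hasFDerivAt_transition he he' hu.2 (hAe' hu.1)).hasFDerivWithinAt) hinj]
  refine setLIntegral_congr_fun (measurableSet_chart_symm_preimage e hA) fun u hu ↦ ?_
  simp only [Function.comp]
  rw [volDensity_transition he he' hu.2 (hAe' hu.1), ENNReal.ofReal_mul (abs_nonneg _)]

theorem chartVolume_restrict_source
    (e : OpenPartialHomeomorph M (EuclideanSpace ℝ (Fin n))) :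
    (chartVolume e).restrict e.source = chartVolume e := by
  refine Measure.restrict_eq_self_of_ae_mem ?_
  rw [ae_iff]
  refine (chartVolume_apply e e.open_source.measurableSet.compl).trans ?_
  have : e.symm ⁻¹' e.sourceᶜ ∩ e.target = ∅ := by
    ext u
    simpa using fun h hu ↦ h (e.map_target hu)
  rw [this]
  simp

/-- The Riemannian volume is given by `chartVolume e` on the domain of the chart `e`. -/
theorem riemannianVolume_restrict_source (he : e ∈ atlas (EuclideanSpace ℝ (Fin n)) M) :
    (riemannianVolume n M).restrict e.source = chartVolume e := by
  refine le_antisymm ?_ ?_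
  -- It is enough to bound each `chartVolume e'`: its part inside `e.source` lives on the overlap,
  -- where it agrees with `chartVolume e`.
  · have hle : riemannianVolume n M ≤
        chartVolume e + (riemannianVolume n M).restrict e.sourceᶜ := by
      refine iSup_le fun ⟨e', he'⟩ ↦ ?_
      rw [← Measure.restrict_add_restrict_compl (μ := chartVolume e') e.open_source.measurableSet]
      refine add_le_add (Measure.le_iff.2 fun A hA ↦ ?_) (Measure.restrict_mono le_rfl
        (le_iSup (fun e : atlas (EuclideanSpace ℝ (Fin n)) M ↦ chartVolume e.1) ⟨e', he'⟩))
      rw [Measure.restrict_apply hA, ← chartVolume_restrict_source e',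
        Measure.restrict_apply (hA.inter e.open_source.measurableSet),
        ← chartVolume_eq_of_subset he he'
          ((hA.inter e.open_source.measurableSet).inter e'.open_source.measurableSet)
          (fun x hx ↦ hx.1.2) (fun x hx ↦ hx.2)]
      exact measure_mono fun x hx ↦ hx.1.1
    refine (Measure.restrict_mono le_rfl hle).trans ?_
    rw [Measure.restrict_add, Measure.restrict_restrict e.open_source.measurableSet,
      Set.inter_compl_self, Measure.restrict_empty, add_zero, chartVolume_restrict_source]
  · rw [← chartVolume_restrict_source e]
    exact Measure.restrict_mono le_rfl
      (le_iSup (fun e : atlas (EuclideanSpace ℝ (Fin n)) M ↦ chartVolume e.1) ⟨e, he⟩)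

variable [T2Space M] [IsContMDiffRiemannianBundle (𝓡 n) ∞ (EuclideanSpace ℝ (Fin n))
      (fun x : M ↦ TangentSpace (𝓡 n) x)]

theorem riemannianVolume_restrict (he : e ∈ atlas (EuclideanSpace ℝ (Fin n)) M) {K : Set M}
    (hK : MeasurableSet K) (hKe : K ⊆ e.source) :
    (riemannianVolume n M).restrict K = (chartVolume e).restrict K := by
  rw [← riemannianVolume_restrict_source he, Measure.restrict_restrict hK,
    Set.inter_eq_left.2 hKe]

theorem riemannianVolume_lt_top_of_subset_source (he : e ∈ atlas (EuclideanSpace ℝ (Fin n)) M)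
    {K : Set M} (hK : IsCompact K) (hKe : K ⊆ e.source) : riemannianVolume n M K < ⊤ := by
  rw [← Measure.restrict_apply_self, riemannianVolume_restrict he hK.measurableSet hKe,
    Measure.restrict_apply_self, chartVolume_apply e hK.measurableSet,
    chart_symm_preimage_inter_target hKe]
  have h : IntegrableOn (volDensity e) (e '' K) :=
    ((contDiffOn_volDensity he).continuousOn.mono
      (chart_image_subset_target hKe)).integrableOn_compact (isCompact_chart_image hK hKe)
  exact h.lintegral_lt_top

theorem riemannianVolume_lt_top {K : Set M} (hK : IsCompact K) :
    riemannianVolume n M K < ⊤ := by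
  have : IsLocallyFiniteMeasure (riemannianVolume n M) := by
    refine ⟨fun x ↦ ?_⟩
    have : LocallyCompactSpace M := Manifold.locallyCompact_of_finiteDimensional (𝓡 n)
    obtain ⟨L, hL, hLs, hLc⟩ := LocallyCompactSpace.local_compact_nhds x _
      ((chartAt (EuclideanSpace ℝ (Fin n)) x).open_source.mem_nhds
        (mem_chart_source (EuclideanSpace ℝ (Fin n)) x))
    exact ⟨L, hL, riemannianVolume_lt_top_of_subset_source (chart_mem_atlas _ x) hLc hLs⟩
  exact hK.measure_lt_top

theorem setIntegral_riemannianVolume (he : e ∈ atlas (EuclideanSpace ℝ (Fin n)) M)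
    {K : Set M} (hK : IsCompact K) (hKe : K ⊆ e.source) {f : M → ℝ} (hf : ContinuousOn f K) :
    ∫ x in K, f x ∂(riemannianVolume n M) =
      ∫ u in e '' K, volDensity e u * f (e.symm u) := by
  have hKm := hK.measurableSet
  have hmeas : AEStronglyMeasurable f ((chartVolume e).restrict K) :=
    (hf.aemeasurable hKm).aestronglyMeasurable
  have hsub := chart_image_subset_target hKe
  have hvol : ContinuousOn (volDensity e) (e '' K) :=
    (contDiffOn_volDensity he).continuousOn.mono hsub
  have hm := (isCompact_chart_image hK hKe).measurableSet
  rw [riemannianVolume_restrict he hKm hKe]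
  rw [chartVolume_restrict e hKm, chart_symm_preimage_inter_target hKe] at hmeas ⊢
  have hsymm : AEMeasurable e.symm ((volume.restrict (e '' K)).withDensity
      fun u ↦ ENNReal.ofReal (volDensity e u)) :=
    ((e.continuousOn_symm.mono hsub).aemeasurable hm).mono_ac (withDensity_absolutelyContinuous _ _)
  rw [integral_map hsymm hmeas, integral_withDensity_eq_integral_toReal_smul₀
    (hvol.aemeasurable hm).ennreal_ofReal (by simp)]
  refine setIntegral_congr_fun hm fun u hu ↦ ?_
  simp [(volDensity_pos he (hsub hu)).le]

end Volume

/-! ### Differentiation under the integral sign -/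

section ParametricIntegral

/-- Differentiation under the integral sign over a compact set. -/
theorem hasDerivAt_setIntegral_of_continuous {X : Type*} [TopologicalSpace X] [T2Space X]
    [MeasurableSpace X] [BorelSpace X] {ν : Measure X} {K : Set X} (hK : IsCompact K)
    (hν : ν K < ⊤) {f f' : X → ℝ → ℝ} (hf : Continuous (Function.uncurry f))
    (hf' : Continuous (Function.uncurry f')) (hd : ∀ x t, HasDerivAt (f x) (f' x t) t) (t₀ : ℝ) :
    HasDerivAt (fun t ↦ ∫ x in K, f x t ∂ν) (∫ x in K, f' x t₀ ∂ν) t₀ := by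
  have hKm := hK.measurableSet
  have : IsFiniteMeasure (ν.restrict K) := isFiniteMeasure_restrict.2 hν.ne
  have hm {g : X → ℝ} (hg : Continuous g) : AEStronglyMeasurable g (ν.restrict K) :=
    (hg.continuousOn.aemeasurable hKm).aestronglyMeasurable
  have hft (t : ℝ) : Continuous fun x ↦ f x t := hf.comp (Continuous.prodMk_left t)
  have hft' (t : ℝ) : Continuous fun x ↦ f' x t := hf'.comp (Continuous.prodMk_left t)
  -- The dominating constant: a bound for `f'` on a compact neighbourhood of `K × {t₀}` in the time
  -- direction.
  obtain ⟨C, hC⟩ := (hK.prod (isCompact_closedBall t₀ 1)).exists_bound_of_continuousOn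
    hf'.continuousOn
  obtain ⟨C', hC'⟩ := hK.exists_bound_of_continuousOn (hft t₀).continuousOn
  refine (hasDerivAt_integral_of_dominated_loc_of_deriv_le (F := fun t x ↦ f x t)
    (F' := fun t x ↦ f' x t) (bound := fun _ ↦ C) (Metric.closedBall_mem_nhds t₀ one_pos)
    (Filter.Eventually.of_forall fun t ↦ hm (hft t)) ?_ (hm (hft' t₀)) ?_ (integrable_const C)
    (Filter.Eventually.of_forall fun x t _ ↦ hd x t)).2
  · exact Integrable.of_bound (hm (hft t₀)) C' ((ae_restrict_iff' hKm).2
      (Filter.Eventually.of_forall hC'))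
  · exact (ae_restrict_iff' hKm).2 (Filter.Eventually.of_forall fun x hx t ht ↦ hC (x, t) ⟨hx, ht⟩)

variable {n : ℕ} {M : Type*} [TopologicalSpace M]
  [ChartedSpace (EuclideanSpace ℝ (Fin n)) M]

/-- A function on `M × ℝ` which is smooth in charts is continuous, and so is its derivative in the
second variable. -/
theorem continuous_deriv_of_contDiffAt_chart {f : M → ℝ → ℝ}
    (hf : ∀ e ∈ atlas (EuclideanSpace ℝ (Fin n)) M, ∀ u ∈ e.target, ∀ t : ℝ,
      ContDiffAt ℝ ∞ (fun z : EuclideanSpace ℝ (Fin n) × ℝ ↦ f (e.symm z.1) z.2) (u, t)) :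
    Continuous (Function.uncurry f) ∧ (∀ x t, HasDerivAt (f x) (deriv (f x) t) t) ∧
      Continuous (Function.uncurry fun x t ↦ deriv (f x) t) := by
  -- In every chart the time derivative is the total derivative in the direction `(0, 1)`, whose
  -- continuity is known.
  have hd (e) (he : e ∈ atlas (EuclideanSpace ℝ (Fin n)) M) (x) (hx : x ∈ e.source) (t : ℝ) :
      HasDerivAt (f x) (fderiv ℝ (fun z : EuclideanSpace ℝ (Fin n) × ℝ ↦ f (e.symm z.1) z.2)
        (e x, t) (0, 1)) t := by
    have h1 := ((hf e he (e x) (e.map_source hx) t).differentiableAt (by simp)).hasFDerivAt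
    have h2 := h1.comp_hasDerivAt t ((hasDerivAt_const t (e x)).prodMk (hasDerivAt_id t))
    simpa [Function.comp_def, e.left_inv hx] using h2
  have hchart (x : M) (t : ℝ) : ContinuousAt (fun z : M × ℝ ↦
      ((chartAt (EuclideanSpace ℝ (Fin n)) x) z.1, z.2)) (x, t) :=
    (((chartAt (EuclideanSpace ℝ (Fin n)) x).continuousAt (mem_chart_source _ x)).comp
      continuousAt_fst).prodMk continuousAt_snd
  have hev (x : M) (t : ℝ) : ∀ᶠ z : M × ℝ in nhds (x, t),
      z.1 ∈ (chartAt (EuclideanSpace ℝ (Fin n)) x).source :=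
    continuousAt_fst.eventually_mem ((chartAt (EuclideanSpace ℝ (Fin n)) x).open_source.mem_nhds
      (mem_chart_source _ x))
  refine ⟨continuous_iff_continuousAt.2 fun ⟨x, t⟩ ↦ ?_,
    fun x t ↦ (hd _ (chart_mem_atlas _ x) x (mem_chart_source _ x) t).differentiableAt.hasDerivAt,
    continuous_iff_continuousAt.2 fun ⟨x, t⟩ ↦ ?_⟩
  · have h := hf _ (chart_mem_atlas _ x) _ (mem_chart_target _ x) t
    refine (ContinuousAt.comp (f := fun z : M × ℝ ↦
      ((chartAt (EuclideanSpace ℝ (Fin n)) x) z.1, z.2)) (x := (x, t)) h.continuousAt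
      (hchart x t)).congr ?_
    filter_upwards [hev x t] with z hz
    simp [Function.uncurry, (chartAt (EuclideanSpace ℝ (Fin n)) x).left_inv hz]
  · have h := ((hf _ (chart_mem_atlas _ x) _ (mem_chart_target _ x) t).fderiv_right
      (m := ∞) le_rfl).continuousAt.clm_apply (continuousAt_const (y := ((0, 1) : _ × ℝ)))
    refine (ContinuousAt.comp (f := fun z : M × ℝ ↦
      ((chartAt (EuclideanSpace ℝ (Fin n)) x) z.1, z.2)) (x := (x, t)) h (hchart x t)).congr ?_
    filter_upwards [hev x t] with z hz
    exact (hd _ (chart_mem_atlas _ x) z.1 hz z.2).deriv.symm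

end ParametricIntegral

/-! ### Comparison with the density for `p = q = 0` -/

section PointwiseBounds

theorem verticalMetric_zero_zero {W : Type*} [NormedAddCommGroup W] [InnerProductSpace ℝ W]
    (e a : W) : verticalMetric 0 0 e a a = ‖a‖ ^ 2 := by
  simp [verticalMetric]

/-- By Cauchy-Schwarz. For negative `q` the vertical metric may be indefinite; this bound reduces
questions of vanishing to the nonnegative case `p = q = 0`. -/
theorem abs_verticalMetric_le {W : Type*} [NormedAddCommGroup W] [InnerProductSpace ℝ W]
    (p q : ℝ) (e a : W) : |verticalMetric p q e a a| ≤
      (1 / (1 + ‖e‖ ^ 2)) ^ p * (1 + |q| * ‖e‖ ^ 2) * verticalMetric 0 0 e a a := by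
  have hw : 0 ≤ (1 / (1 + ‖e‖ ^ 2)) ^ p := by positivity
  rw [verticalMetric_zero_zero, verticalMetric, abs_mul, abs_of_nonneg hw,
    real_inner_self_eq_norm_sq]
  refine (mul_le_mul_of_nonneg_left ?_ hw).trans_eq (mul_assoc _ _ _).symm
  refine (abs_add_le _ _).trans ?_
  rw [abs_of_nonneg (sq_nonneg ‖a‖), abs_mul, abs_mul]
  nlinarith [mul_le_mul (abs_real_inner_le_norm a e) (abs_real_inner_le_norm a e) (abs_nonneg _)
    (by positivity), abs_nonneg q]

variable {n : ℕ} {M : Type*} [TopologicalSpace M] [ChartedSpace (EuclideanSpace ℝ (Fin n)) M]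
  [RiemannianBundle (fun x : M ↦ TangentSpace (𝓡 n) x)]
  {F : Type*} [NormedAddCommGroup F] [NormedSpace ℝ F]
  {V : M → Type*} [TopologicalSpace (TotalSpace F V)]
  [∀ x, NormedAddCommGroup (V x)] [∀ x, InnerProductSpace ℝ (V x)] [FiberBundle F V]

theorem abs_verticalDensity_le (cov : CovariantDerivative (𝓡 n) F V) (p q : ℝ) (σ : ∀ x, V x)
    (x : M) : |verticalDensity cov p q σ x| ≤
      (1 / (1 + ‖σ x‖ ^ 2)) ^ p * (1 + |q| * ‖σ x‖ ^ 2) * verticalDensity cov 0 0 σ x := by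
  rw [verticalDensity, verticalDensity, Finset.mul_sum]
  exact (Finset.abs_sum_le_sum_abs _ _).trans (Finset.sum_le_sum fun i _ ↦
    abs_verticalMetric_le p q _ _)

theorem verticalDensity_zero_nonneg (cov : CovariantDerivative (𝓡 n) F V) (σ : ∀ x, V x) (x : M) :
    0 ≤ verticalDensity cov 0 0 σ x :=
  Finset.sum_nonneg fun i _ ↦ by rw [verticalMetric_zero_zero]; positivity

end PointwiseBounds

/-! ### First variation of the energy; parallel sections are critical -/

section FirstVariation

variable {n : ℕ} {M : Type*} [TopologicalSpace M] [T2Space M]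
  [ChartedSpace (EuclideanSpace ℝ (Fin n)) M] [IsManifold (𝓡 n) ∞ M]
  [RiemannianBundle (fun x : M ↦ TangentSpace (𝓡 n) x)]
  [IsContMDiffRiemannianBundle (𝓡 n) ∞ (EuclideanSpace ℝ (Fin n))
      (fun x : M ↦ TangentSpace (𝓡 n) x)]
  {F : Type*} [NormedAddCommGroup F] [NormedSpace ℝ F] [FiniteDimensional ℝ F]
  {V : M → Type*} [TopologicalSpace (TotalSpace F V)]
  [∀ x, NormedAddCommGroup (V x)] [∀ x, InnerProductSpace ℝ (V x)]
  [FiberBundle F V] [VectorBundle ℝ F V] [ContMDiffVectorBundle ∞ F V (𝓡 n)]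
  [IsContMDiffRiemannianBundle (𝓡 n) ∞ F V]

theorem continuous_deriv_verticalDensity (cov : CovariantDerivative (𝓡 n) F V)
    (hcov : CovariantDerivative.ContMDiffCovariantDerivative cov ∞) (p q : ℝ) {s : ℝ → ∀ x, V x}
    (hs : ContMDiff ((𝓡 n).prod 𝓘(ℝ, ℝ)) ((𝓡 n).prod 𝓘(ℝ, F)) ∞
      (fun z : M × ℝ ↦ TotalSpace.mk' F z.1 (s z.2 z.1))) :
    Continuous (Function.uncurry fun x t ↦ verticalDensity cov p q (s t) x) ∧
      (∀ x t, HasDerivAt (fun t ↦ verticalDensity cov p q (s t) x)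
        (deriv (fun t ↦ verticalDensity cov p q (s t) x) t) t) ∧
      Continuous (Function.uncurry fun x t ↦
        deriv (fun t ↦ verticalDensity cov p q (s t) x) t) :=
  continuous_deriv_of_contDiffAt_chart (f := fun x t ↦ verticalDensity cov p q (s t) x)
    (fun _ he _ hu t ↦ contDiffAt_verticalDensity cov hcov he hu t p q s hs)

theorem hasDerivAt_verticalEnergy [MeasurableSpace M] [BorelSpace M]
    (cov : CovariantDerivative (𝓡 n) F V)
    (hcov : CovariantDerivative.ContMDiffCovariantDerivative cov ∞) (p q : ℝ) {K : Set M}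
    (hK : IsCompact K) {s : ℝ → ∀ x, V x}
    (hs : ContMDiff ((𝓡 n).prod 𝓘(ℝ, ℝ)) ((𝓡 n).prod 𝓘(ℝ, F)) ∞
      (fun z : M × ℝ ↦ TotalSpace.mk' F z.1 (s z.2 z.1))) :
    HasDerivAt (fun t ↦ verticalEnergy cov p q K (s t))
      (1 / 2 * ∫ x in K, deriv (fun t ↦ verticalDensity cov p q (s t) x) 0
        ∂(riemannianVolume n M)) 0 := by
  obtain ⟨h1, h2, h3⟩ := continuous_deriv_verticalDensity cov hcov p q hs
  exact (hasDerivAt_setIntegral_of_continuous hK (riemannianVolume_lt_top hK) h1 h3 h2 0).const_mul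
    (1 / 2)

/-- For `p = q = 0` the density is nonnegative and vanishes at `t = 0`, which is therefore a minimum
with zero derivative. The general density is `O` of this one, hence also `o(t)`. -/
theorem hasDerivAt_verticalDensity_of_cov_eq_zero (cov : CovariantDerivative (𝓡 n) F V)
    (hcov : CovariantDerivative.ContMDiffCovariantDerivative cov ∞) (p q : ℝ)
    {s : ℝ → ∀ x, V x}
    (hs : ContMDiff ((𝓡 n).prod 𝓘(ℝ, ℝ)) ((𝓡 n).prod 𝓘(ℝ, F)) ∞
      (fun z : M × ℝ ↦ TotalSpace.mk' F z.1 (s z.2 z.1))) {x : M} (h0 : cov (s 0) x = 0) :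
    HasDerivAt (fun t ↦ verticalDensity cov p q (s t) x) 0 0 := by
  have hzero (p q : ℝ) : verticalDensity cov p q (s 0) x = 0 := by
    simp [verticalDensity, h0, verticalMetric]
  have hd := (continuous_deriv_verticalDensity cov hcov 0 0 hs).2.1 x 0
  have hmin : IsLocalMin (fun t ↦ verticalDensity cov 0 0 (s t) x) 0 :=
    Filter.Eventually.of_forall fun t ↦ by
      simpa only [hzero 0 0] using verticalDensity_zero_nonneg cov (s t) x
  rw [hmin.deriv_eq_zero] at hd
  have hnorm : Continuous fun t ↦ ‖s t x‖ ^ 2 := by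
    have := ((hs.inner_bundle hs).continuous).comp (Continuous.prodMk_right x)
    simpa only [Function.comp_def, real_inner_self_eq_norm_sq] using this
  have hpos (t : ℝ) : 0 < 1 + ‖s t x‖ ^ 2 := by positivity
  have hC : Continuous fun t ↦ (1 / (1 + ‖s t x‖ ^ 2)) ^ p * (1 + |q| * ‖s t x‖ ^ 2) :=
    ((continuous_const.div (continuous_const.add hnorm) fun t ↦ (hpos t).ne').rpow_const
      fun t ↦ Or.inl (one_div_pos.2 (hpos t)).ne').mul
      (continuous_const.add (continuous_const.mul hnorm))
  have hO : (fun t ↦ verticalDensity cov p q (s t) x) =O[nhds 0]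
      fun t ↦ verticalDensity cov 0 0 (s t) x := by
    refine Asymptotics.IsBigO.of_bound
      ((1 / (1 + ‖s 0 x‖ ^ 2)) ^ p * (1 + |q| * ‖s 0 x‖ ^ 2) + 1) ?_
    filter_upwards [hC.continuousAt.eventually_lt continuousAt_const (lt_add_one _)] with t ht
    rw [Real.norm_eq_abs, Real.norm_eq_abs, abs_of_nonneg (verticalDensity_zero_nonneg cov (s t) x)]
    exact (abs_verticalDensity_le cov p q (s t) x).trans
      (mul_le_mul_of_nonneg_right ht.le (verticalDensity_zero_nonneg cov (s t) x))
  rw [hasDerivAt_iff_isLittleO] at hd ⊢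
  simp only [hzero, sub_zero, smul_zero] at hd ⊢
  exact hO.trans_isLittleO hd

theorem isHarmonicSection_of_isParallel [MeasurableSpace M] [BorelSpace M]
    (cov : CovariantDerivative (𝓡 n) F V)
    (hcov : CovariantDerivative.ContMDiffCovariantDerivative cov ∞) (p q : ℝ) {σ : ∀ x, V x}
    (hσ : IsParallel cov σ) : IsHarmonicSection cov p q σ := by
  intro K hK s hs
  have h := hasDerivAt_verticalEnergy cov hcov p q hK hs.smooth
  have hzero (x : M) : deriv (fun t ↦ verticalDensity cov p q (s t) x) 0 = 0 :=
    (hasDerivAt_verticalDensity_of_cov_eq_zero cov hcov p q hs.smooth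
      (by rw [hs.zero, hσ x])).deriv
  simpa [hzero] using h

end FirstVariation

/-! ### Positivity in the region, and the derivative under rescaling -/

section Algebra

/-- In the region `𝓕(μ)` the quadratic form of the first variation is positive definite. -/
theorem exists_pos_mul_le_of_mem_region {μ p q N a b : ℝ} (hμ : 1 / 2 ≤ μ)
    (hpq : (p, q) ∈ region μ) (hN : 0 ≤ N) (hR : -1 ≤ μ * q * N) (ha : 0 ≤ a) (hb : 0 ≤ b)
    (hab : b ≤ N * a) :
    ∃ c : ℝ, 0 < c ∧ c * a ≤ (1 + N - p * N) * a + (2 * p + p * q * N) * b := by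
  -- For `q < 0`, `μ ≥ 1/2` gives `qN / 2 ≥ μqN ≥ -1`.
  have hqN : 0 ≤ 2 + q * N := by
    rcases le_or_gt 0 q with hq | hq
    · positivity
    · nlinarith [mul_nonneg (sub_nonneg.2 hμ) (mul_nonneg (neg_pos.2 hq).le hN)]
  rcases hpq with (⟨hp, hq⟩ | ⟨hp, hp'⟩) | ⟨hp, hq⟩ <;> simp only at *
  · have hq0 : q < 0 := by
      by_contra! h
      nlinarith [mul_nonneg (by linarith : (0 : ℝ) ≤ μ) h]
    -- The coefficient of `b` is nonpositive, so the worst case is `b = N a`, with total coefficient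
    -- `1 + N + pN + pqN²`. Here `2pN ≥ μqN ≥ -1` and `pq > 0`, so this is at least `1/2`.
    refine ⟨1 / 2, by norm_num, ?_⟩
    have h1 : p * (2 + q * N) * (N * a) ≤ p * (2 + q * N) * b :=
      mul_le_mul_of_nonpos_left hab (mul_nonpos_of_nonpos_of_nonneg hp.le hqN)
    have h2 : -(1 / 2) ≤ p * N := by nlinarith [mul_le_mul_of_nonneg_right hq hN]
    have h3 : 0 ≤ p * q * N ^ 2 :=
      mul_nonneg (mul_nonneg_of_nonpos_of_nonpos hp.le hq0.le) (sq_nonneg N)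
    have h4 : 1 / 2 * a ≤ (1 + N + p * N + p * q * N ^ 2) * a :=
      mul_le_mul_of_nonneg_right (by linarith) ha
    linarith [h1, h4]
  · refine ⟨1, one_pos, ?_⟩
    have h1 : 0 ≤ p * (2 + q * N) * b := mul_nonneg (mul_nonneg hp hqN) hb
    have h2 : 0 ≤ N * (1 - p) * a := mul_nonneg (mul_nonneg hN (by linarith)) ha
    linarith
  -- If `N > 0`, then `(1 - p)N > μqN ≥ -1`, by the strict inequality in `regionOne`. The constant
  -- depends on the point, which is harmless.
  · refine ⟨1 + N - p * N, ?_, ?_⟩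
    · rcases hN.eq_or_lt with rfl | hN
      · simp
      · nlinarith [mul_lt_mul_of_pos_right hq hN]
    · have h1 : 0 ≤ p * (2 + q * N) * b := mul_nonneg (mul_nonneg (by linarith) hqN) hb
      linarith

/-- The factor `w^p (1 + q r)`, `w = 1 / (1 + r)`, of `dφ` in the first variation. -/
noncomputable def weight (p q r : ℝ) : ℝ := (1 / (1 + r)) ^ p * (1 + q * r)

theorem hasDerivAt_weight (p q : ℝ) {r : ℝ} (hr : 0 ≤ r) :
    HasDerivAt (weight p q) ((1 / (1 + r)) ^ (p + 1) * (q * (1 + r) - p * (1 + q * r))) r := by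
  have hr' : (0 : ℝ) < 1 + r := by positivity
  have hw : (0 : ℝ) < 1 / (1 + r) := by positivity
  have h1 : HasDerivAt (fun r : ℝ ↦ 1 / (1 + r)) (-1 / (1 + r) ^ 2) r := by
    simp only [one_div]
    exact ((hasDerivAt_id r).const_add 1).inv hr'.ne'
  have h2 := (h1.rpow_const (p := p) (Or.inl hw.ne')).mul
    (((hasDerivAt_id r).const_mul q).const_add 1)
  refine h2.congr_deriv ?_
  rw [Real.rpow_sub hw, Real.rpow_add hw, Real.rpow_one]
  simp only [id]
  field_simp
  ring

theorem contDiffAt_weight (p q : ℝ) {r : ℝ} (hr : 0 ≤ r) : ContDiffAt ℝ ∞ (weight p q) r := by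
  have hr' : (0 : ℝ) < 1 + r := by positivity
  exact ((contDiffAt_const.div (contDiffAt_const.add contDiffAt_id) hr'.ne').rpow_const_of_ne
    (one_div_pos.2 hr').ne').mul (contDiffAt_const.add (contDiffAt_const.mul contDiffAt_id))

variable {W : Type*} [NormedAddCommGroup W] [InnerProductSpace ℝ W]

/-- To be read with `e = σ`, `a = ∇_X σ`, `f = φ`, `f' = dφ(X)`, so that `2⟨a, e⟩ = d|σ|²(X)`. The
multiple of `f ⟨a, e⟩²` containing the derivative of `weight` is split off so that the last summand
becomes `d(φ · weight)(X) · d|σ|²(X)`. -/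
theorem hasDerivAt_verticalMetric (p q f f' : ℝ) (e a : W) :
    HasDerivAt (fun t : ℝ ↦ verticalMetric p q ((1 + t * f) • e)
        ((1 + t * f) • a + (t * f') • e) ((1 + t * f) • a + (t * f') • e))
      (2 * (f * (1 / (1 + ‖e‖ ^ 2)) ^ (p + 1) * ((1 + ‖e‖ ^ 2 - p * ‖e‖ ^ 2) * ‖a‖ ^ 2 +
          (2 * p + p * q * ‖e‖ ^ 2) * inner ℝ a e ^ 2)) +
        (f' * weight p q (‖e‖ ^ 2) + f * ((1 / (1 + ‖e‖ ^ 2)) ^ (p + 1) *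
          (q * (1 + ‖e‖ ^ 2) - p * (1 + q * ‖e‖ ^ 2))) * (2 * inner ℝ a e)) *
          (2 * inner ℝ a e)) 0 := by
  set N := ‖e‖ ^ 2 with hNdef
  set l : ℝ := inner ℝ a e with hl
  have hN : 0 ≤ N := sq_nonneg _
  have hr' : (0 : ℝ) < 1 + N := by positivity
  have hw : (0 : ℝ) < 1 / (1 + N) := by positivity
  have hfun : (fun t : ℝ ↦ verticalMetric p q ((1 + t * f) • e)
        ((1 + t * f) • a + (t * f') • e) ((1 + t * f) • a + (t * f') • e)) = fun t : ℝ ↦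
      (1 / (1 + (1 + t * f) ^ 2 * N)) ^ p *
        ((1 + t * f) ^ 2 * ‖a‖ ^ 2 + 2 * (1 + t * f) * (t * f') * l + (t * f') ^ 2 * N +
          q * ((1 + t * f) ^ 2 * l + (1 + t * f) * (t * f') * N) ^ 2) := by
    funext t
    have h1 : ‖(1 + t * f) • e‖ ^ 2 = (1 + t * f) ^ 2 * N := by
      rw [norm_smul, mul_pow, Real.norm_eq_abs, sq_abs]
    rw [verticalMetric, h1]
    simp only [inner_add_left, inner_add_right, inner_smul_left, inner_smul_right, conj_trivial,
      real_inner_self_eq_norm_sq, real_inner_comm a e, ← hNdef, ← hl]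
    ring
  rw [hfun]
  have hu : HasDerivAt (fun t : ℝ ↦ 1 + t * f) f 0 := by
    simpa using ((hasDerivAt_id (0 : ℝ)).mul_const f).const_add 1
  have hv : HasDerivAt (fun t : ℝ ↦ t * f') f' 0 := by
    simpa using (hasDerivAt_id (0 : ℝ)).mul_const f'
  have hD := ((hu.pow 2).mul_const N).const_add 1
  have h1 := ((hasDerivAt_const (0 : ℝ) (1 : ℝ)).div hD (by simpa using hr'.ne')).rpow_const (p := p)
    (Or.inl (by simpa using hr'.ne'))
  have h2 := ((((hu.pow 2).mul_const (‖a‖ ^ 2)).add (((hu.const_mul 2).mul hv).mul_const l)).add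
    ((hv.pow 2).mul_const N)).add
    (((((hu.pow 2).mul_const l).add ((hu.mul hv).mul_const N)).pow 2).const_mul q)
  refine (h1.mul h2).congr_deriv ?_
  simp only [Pi.pow_apply, Pi.add_apply, Pi.mul_apply, zero_mul, add_zero, mul_zero, one_pow, one_mul,
    Pi.div_apply]
  rw [Real.rpow_sub hw, Real.rpow_add hw, Real.rpow_one, weight]
  field_simp
  ring

end Algebra

/-! ### Green's formula in a chart -/

section Divergence

variable {n : ℕ}

/-- The divergence of a `C¹` vector field with compact support integrates to zero. -/
theorem integral_partialDeriv_eq_zero {G : EuclideanSpace ℝ (Fin n) → ℝ} (hG : ContDiff ℝ 1 G)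
    (hc : HasCompactSupport G) (i : Fin n) : ∫ u, partialDeriv i G u = 0 := by
  have hcont : Continuous fun u ↦ fderiv ℝ G u (EuclideanSpace.single i (1 : ℝ)) :=
    (hG.continuous_fderiv one_ne_zero).clm_apply continuous_const
  have hcs : HasCompactSupport fun u ↦ fderiv ℝ G u (EuclideanSpace.single i (1 : ℝ)) :=
    hc.fderiv_apply (𝕜 := ℝ) _
  -- Integration by parts against the constant function `1`.
  have h := integral_mul_fderiv_eq_neg_fderiv_mul_of_integrable
    (μ := (volume : Measure (EuclideanSpace ℝ (Fin n)))) (f := G) (g := fun _ ↦ (1 : ℝ))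
    (v := EuclideanSpace.single i (1 : ℝ)) (by simpa using hcont.integrable_of_hasCompactSupport hcs)
    (by simp) (by simpa using hG.continuous.integrable_of_hasCompactSupport hc)
    (fun u _ ↦ hG.differentiable one_ne_zero u) (fun u _ ↦ differentiableAt_const _)
  simpa [partialDeriv] using h

variable {M : Type*} [TopologicalSpace M] [T2Space M]
  [ChartedSpace (EuclideanSpace ℝ (Fin n)) M] [IsManifold (𝓡 n) ∞ M]
  [RiemannianBundle (fun x : M ↦ TangentSpace (𝓡 n) x)]
  [IsContMDiffRiemannianBundle (𝓡 n) ∞ (EuclideanSpace ℝ (Fin n))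
      (fun x : M ↦ TangentSpace (𝓡 n) x)]
  {e : OpenPartialHomeomorph M (EuclideanSpace ℝ (Fin n))}

theorem contDiffOn_comp_chart_symm (he : e ∈ atlas (EuclideanSpace ℝ (Fin n)) M) {f : M → ℝ}
    (hf : ContMDiff (𝓡 n) 𝓘(ℝ, ℝ) ∞ f) : ContDiffOn ℝ ∞ (f ∘ e.symm) e.target :=
  contMDiffOn_iff_contDiffOn.1 (hf.comp_contMDiffOn (contMDiffOn_chart_symm he))

theorem contDiffOn_partialDeriv {U : Set (EuclideanSpace ℝ (Fin n))} (hU : IsOpen U)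
    {f : EuclideanSpace ℝ (Fin n) → ℝ} (hf : ContDiffOn ℝ ∞ f U) (i : Fin n) :
    ContDiffOn ℝ ∞ (partialDeriv i f) U :=
  (hf.fderiv_of_isOpen hU (m := ∞) le_rfl).clm_apply contDiffOn_const

/-- Green's formula for a harmonic function, in a chart. -/
theorem setIntegral_gradient_inner_eq_zero (he : e ∈ atlas (EuclideanSpace ℝ (Fin n)) M)
    {K : Set M} (hK : IsCompact K) (hKe : K ⊆ e.source) {ψ N : M → ℝ}
    (hψ : ContMDiff (𝓡 n) 𝓘(ℝ, ℝ) ∞ ψ) (hψK : ∀ x ∉ K, ψ x = 0)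
    (hN : ContMDiff (𝓡 n) 𝓘(ℝ, ℝ) ∞ N) (hharm : IsHarmonicFunction n N) :
    ∫ u in e '' K, volDensity e u * ∑ i, ∑ j, (gram e u)⁻¹ i j *
      (partialDeriv i (ψ ∘ e.symm) u * partialDeriv j (N ∘ e.symm) u) = 0 := by
  classical
  have hKc := isCompact_chart_image hK hKe
  have hsub := chart_image_subset_target hKe
  let W (i : Fin n) (v : EuclideanSpace ℝ (Fin n)) : ℝ :=
    volDensity e v * ∑ j, (gram e v)⁻¹ i j * partialDeriv j (N ∘ e.symm) v
  -- Extension by zero from the chart; it stays `C¹` because `ψ` vanishes off the compact set `K`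
  -- inside the chart.
  let G (i : Fin n) : EuclideanSpace ℝ (Fin n) → ℝ :=
    e.target.indicator fun v ↦ (ψ ∘ e.symm) v * W i v
  have hψs := contDiffOn_comp_chart_symm he hψ
  have hNs := contDiffOn_comp_chart_symm he hN
  have hW (i : Fin n) : ContDiffOn ℝ ∞ (W i) e.target :=
    (contDiffOn_volDensity he).mul (ContDiffOn.sum fun j _ ↦
      (contDiffOn_gram_inv he i j).mul (contDiffOn_partialDeriv e.open_target hNs j))
  have hGoff (i : Fin n) (v) (hv : v ∉ e '' K) : G i v = 0 := by
    by_cases hvt : v ∈ e.target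
    · have : e.symm v ∉ K := fun h ↦ hv ⟨e.symm v, h, e.right_inv hvt⟩
      simp [G, hvt, hψK _ this]
    · simp [G, hvt]
  have hGev (i : Fin n) (v) (hv : v ∈ e.target) :
      G i =ᶠ[nhds v] fun v ↦ (ψ ∘ e.symm) v * W i v := by
    filter_upwards [e.open_target.mem_nhds hv] with w hw
    simp [G, hw]
  have hG (i : Fin n) : ContDiff ℝ 1 (G i) := by
    refine contDiff_iff_contDiffAt.2 fun v ↦ ?_
    by_cases hv : v ∈ e.target
    · have h := ((hψs.mul (hW i)).contDiffAt (e.open_target.mem_nhds hv)).of_le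
        (m := 1) (by simp)
      exact h.congr_of_eventuallyEq (hGev i v hv)
    · have hv' : v ∈ (e '' K)ᶜ := fun h ↦ hv (hsub h)
      have h : ContDiffAt ℝ 1 (fun _ : EuclideanSpace ℝ (Fin n) ↦ (0 : ℝ)) v := contDiffAt_const
      exact h.congr_of_eventuallyEq
        (Filter.eventually_of_mem (hKc.isClosed.isOpen_compl.mem_nhds hv') (hGoff i))
  have hGc (i : Fin n) : HasCompactSupport (G i) := HasCompactSupport.intro hKc (hGoff i)
  have hGd (i : Fin n) (v) (hv : v ∉ e '' K) : partialDeriv i (G i) v = 0 := by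
    have : G i =ᶠ[nhds v] fun _ ↦ 0 :=
      Filter.eventually_of_mem (hKc.isClosed.isOpen_compl.mem_nhds hv) (hGoff i)
    simp [partialDeriv, this.fderiv_eq]
  have hint (i : Fin n) : ∫ u in e '' K, partialDeriv i (G i) u = 0 := by
    rw [setIntegral_eq_integral_of_forall_compl_eq_zero (hGd i),
      integral_partialDeriv_eq_zero (hG i) (hGc i) i]
  have hcont (i : Fin n) : Continuous (partialDeriv i (G i)) :=
    ((hG i).continuous_fderiv one_ne_zero).clm_apply continuous_const
  calc _ = ∫ u in e '' K, ∑ i, partialDeriv i (G i) u := by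
        refine setIntegral_congr_fun hKc.measurableSet fun u hu ↦ ?_
        have hut := hsub hu
        have hdiff {f : EuclideanSpace ℝ (Fin n) → ℝ} (hf : ContDiffOn ℝ ∞ f e.target) :
            DifferentiableAt ℝ f u :=
          (hf.contDiffAt (e.open_target.mem_nhds hut)).differentiableAt (by simp)
        have hpart (i : Fin n) : partialDeriv i (G i) u =
            (ψ ∘ e.symm) u * partialDeriv i (W i) u + partialDeriv i (ψ ∘ e.symm) u * W i u := by
          rw [partialDeriv, (hGev i u hut).fderiv_eq, fderiv_fun_mul (hdiff hψs) (hdiff (hW i))]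
          simp [partialDeriv, mul_comm]
        -- Harmonicity of `N` says that the field `W = √(det g) grad N` has zero coordinate
        -- divergence.
        have hlap : ∑ i, partialDeriv i (W i) u = 0 := by
          have h := hharm.2 e he u hut
          rw [laplaceBeltrami, neg_eq_zero, mul_eq_zero, inv_eq_zero] at h
          exact h.resolve_left (volDensity_pos he hut).ne'
        simp only [hpart, Finset.sum_add_distrib, ← Finset.mul_sum, hlap, mul_zero, zero_add]
        rw [Finset.mul_sum]
        refine Finset.sum_congr rfl fun i _ ↦ ?_
        simp only [W, Finset.mul_sum]
        exact Finset.sum_congr rfl fun j _ ↦ by ring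
    _ = 0 := by
        rw [integral_finsetSum _ fun i _ ↦ ((hcont i).continuousOn.integrableOn_compact hKc)]
        simp [hint]

end Divergence

/-! ### Rescaling variations and the proof that critical sections are parallel -/

section ScalingVariation

variable {n : ℕ} {M : Type*} [TopologicalSpace M] [T2Space M]
  [ChartedSpace (EuclideanSpace ℝ (Fin n)) M] [IsManifold (𝓡 n) ∞ M]
  {F : Type*} [NormedAddCommGroup F] [NormedSpace ℝ F] [FiniteDimensional ℝ F]
  {V : M → Type*} [TopologicalSpace (TotalSpace F V)]
  [∀ x, NormedAddCommGroup (V x)] [∀ x, InnerProductSpace ℝ (V x)]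
  [FiberBundle F V] [VectorBundle ℝ F V]
  {σ : ∀ x, V x}

/-- The variation `(1 + t φ) σ` of `σ`. -/
def scalingVariation (φ : M → ℝ) (σ : ∀ x, V x) (t : ℝ) (x : M) : V x := (1 + t * φ x) • σ x

theorem isVariation_scalingVariation
    (hσ : ContMDiff (𝓡 n) ((𝓡 n).prod 𝓘(ℝ, F)) ∞ (fun x ↦ TotalSpace.mk' F x (σ x)))
    {φ : M → ℝ} (hφ : ContMDiff (𝓡 n) 𝓘(ℝ, ℝ) ∞ φ) {K : Set M} (hK : ∀ x ∉ K, φ x = 0) :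
    IsVariation n F K σ (scalingVariation φ σ) where
  smooth z := by
    refine contMDiffAt_smul_along (b := Prod.fst) ?_ (hσ.contMDiffAt.comp z contMDiffAt_fst)
    exact contMDiffAt_const.add (contMDiffAt_snd.mul (hφ.contMDiffAt.comp z contMDiffAt_fst))
  zero := by
    funext x
    simp [scalingVariation]
  eq_off t x hx := by simp [scalingVariation, hK x hx]

theorem covariantDerivative_scalingVariation (cov : CovariantDerivative (𝓡 n) F V)
    (hσ : ContMDiff (𝓡 n) ((𝓡 n).prod 𝓘(ℝ, F)) ∞ (fun x ↦ TotalSpace.mk' F x (σ x)))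
    {φ : M → ℝ} (hφ : ContMDiff (𝓡 n) 𝓘(ℝ, ℝ) ∞ φ) (t : ℝ) (x : M) (X : TangentSpace (𝓡 n) x) :
    cov (scalingVariation φ σ t) x X =
      (1 + t * φ x) • cov σ x X + (t * mvfderiv (𝓡 n) φ x X) • σ x := by
  have hφx : MDifferentiableAt (𝓡 n) 𝓘(ℝ, ℝ) φ x := hφ.mdifferentiableAt (by simp)
  have hg : MDifferentiableAt (𝓡 n) 𝓘(ℝ, ℝ) (fun x ↦ 1 + t * φ x) x :=
    (contMDiff_const.add (contMDiff_const.mul hφ)).mdifferentiableAt (by simp)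
  have h := cov.isCovariantDerivativeOnUniv.leibniz (hσ.mdifferentiableAt (x := x) (by simp)) hg
  have hd : mvfderiv (𝓡 n) (fun x ↦ 1 + t * φ x) x = t • mvfderiv (𝓡 n) φ x := by
    have h1 := mvfderiv_add (g := fun _ : M ↦ (1 : ℝ)) (g' := fun x ↦ t * φ x)
      (mdifferentiableAt_const (I := 𝓡 n) (x := x)) (mdifferentiableAt_const.mul hφx)
    have h2 := mvfderiv_mul (f := fun _ : M ↦ t) (mdifferentiableAt_const (I := 𝓡 n) (x := x)) hφx
    simp only [mvfderiv_const, zero_add, smul_zero, add_zero] at h1 h2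
    exact h1.trans h2
  rw [hd] at h
  exact congr($h X)

variable [ContMDiffVectorBundle ∞ F V (𝓡 n)] [IsContMDiffRiemannianBundle (𝓡 n) ∞ F V]

theorem contMDiff_norm_sq
    (hσ : ContMDiff (𝓡 n) ((𝓡 n).prod 𝓘(ℝ, F)) ∞ (fun x ↦ TotalSpace.mk' F x (σ x))) :
    ContMDiff (𝓡 n) 𝓘(ℝ, ℝ) ∞ fun x ↦ ‖σ x‖ ^ 2 := by
  simpa only [real_inner_self_eq_norm_sq] using hσ.inner_bundle hσ

theorem mvfderiv_norm_sq {cov : CovariantDerivative (𝓡 n) F V} (hmetric : cov.IsMetricCompatible)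
    (hσ : ContMDiff (𝓡 n) ((𝓡 n).prod 𝓘(ℝ, F)) ∞ (fun x ↦ TotalSpace.mk' F x (σ x)))
    (x : M) (X : TangentSpace (𝓡 n) x) :
    mvfderiv (𝓡 n) (fun x ↦ ‖σ x‖ ^ 2) x X = 2 * inner ℝ (cov σ x X) (σ x) := by
  have hx := hσ.mdifferentiableAt (x := x) (by simp)
  have h := hmetric.mvfderiv_inner_eq (fun _ ↦ X) hx hx
  simp only [real_inner_self_eq_norm_sq] at h
  refine h.trans ?_
  rw [real_inner_comm (σ x) (cov σ x X)]
  ring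

theorem contMDiff_mul_weight {φ : M → ℝ} (hφ : ContMDiff (𝓡 n) 𝓘(ℝ, ℝ) ∞ φ)
    (hσ : ContMDiff (𝓡 n) ((𝓡 n).prod 𝓘(ℝ, F)) ∞ (fun x ↦ TotalSpace.mk' F x (σ x))) (p q : ℝ) :
    ContMDiff (𝓡 n) 𝓘(ℝ, ℝ) ∞ fun x ↦ φ x * weight p q (‖σ x‖ ^ 2) := fun x ↦
  hφ.contMDiffAt.mul ((contDiffAt_weight p q (sq_nonneg ‖σ x‖)).contMDiffAt.comp x
    (contMDiff_norm_sq hσ x))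

theorem mvfderiv_mul_weight {φ : M → ℝ} (hφ : ContMDiff (𝓡 n) 𝓘(ℝ, ℝ) ∞ φ)
    (hσ : ContMDiff (𝓡 n) ((𝓡 n).prod 𝓘(ℝ, F)) ∞ (fun x ↦ TotalSpace.mk' F x (σ x))) (p q : ℝ)
    (x : M) (X : TangentSpace (𝓡 n) x) :
    mvfderiv (𝓡 n) (fun x ↦ φ x * weight p q (‖σ x‖ ^ 2)) x X =
      mvfderiv (𝓡 n) φ x X * weight p q (‖σ x‖ ^ 2) +
      φ x * ((1 / (1 + ‖σ x‖ ^ 2)) ^ (p + 1) *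
          (q * (1 + ‖σ x‖ ^ 2) - p * (1 + q * ‖σ x‖ ^ 2))) *
        mvfderiv (𝓡 n) (fun x ↦ ‖σ x‖ ^ 2) x X := by
  have hw := hasDerivAt_weight p q (sq_nonneg ‖σ x‖)
  have hN : MDifferentiableAt (𝓡 n) 𝓘(ℝ, ℝ) (fun x ↦ ‖σ x‖ ^ 2) x :=
    (contMDiff_norm_sq hσ).mdifferentiableAt (by simp)
  have hwM : MDifferentiableAt 𝓘(ℝ, ℝ) 𝓘(ℝ, ℝ) (weight p q) (‖σ x‖ ^ 2) :=
    hw.differentiableAt.mdifferentiableAt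
  have h1 := mvfderiv_mul (hφ.mdifferentiableAt (x := x) (by simp)) (hwM.comp x hN)
  have h2 : mvfderiv (𝓡 n) (weight p q ∘ fun x ↦ ‖σ x‖ ^ 2) x X =
      mvfderiv (𝓡 n) (fun x ↦ ‖σ x‖ ^ 2) x X * ((1 / (1 + ‖σ x‖ ^ 2)) ^ (p + 1) *
          (q * (1 + ‖σ x‖ ^ 2) - p * (1 + q * ‖σ x‖ ^ 2))) := by
    have h3 := mfderiv_comp x hwM hN
    rw [mfderiv_eq_fderiv, hw.hasFDerivAt.fderiv] at h3
    exact congr($h3 X)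
  have h4 := congr($h1 X)
  refine h4.trans ?_
  rw [add_apply, smul_apply, smul_apply, h2]
  simp only [smul_eq_mul, Function.comp_apply]
  ring

variable [RiemannianBundle (fun x : M ↦ TangentSpace (𝓡 n) x)]

/-- The zeroth order part of the first variation of the energy in the direction `φ σ`. -/
noncomputable def variationForm (cov : CovariantDerivative (𝓡 n) F V) (p q : ℝ) (σ : ∀ x, V x)
    (x : M) : ℝ :=
  (1 + ‖σ x‖ ^ 2 - p * ‖σ x‖ ^ 2) * verticalDensity cov 0 0 σ x +
    (2 * p + p * q * ‖σ x‖ ^ 2) * (verticalDensity cov 0 1 σ x - verticalDensity cov 0 0 σ x)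

/-- This explains the differences of densities in `variationForm`: they encode `∑ ⟨∇σ, σ⟩²` and
inherit continuity from the densities. -/
theorem verticalDensity_zero_one_sub (cov : CovariantDerivative (𝓡 n) F V) (σ : ∀ x, V x) (x : M)
    [FiniteDimensional ℝ (TangentSpace (𝓡 n) x)] :
    verticalDensity cov 0 1 σ x - verticalDensity cov 0 0 σ x =
      ∑ k, inner ℝ (cov σ x (stdOrthonormalBasis ℝ (TangentSpace (𝓡 n) x) k)) (σ x) ^ 2 := by
  rw [verticalDensity, verticalDensity, ← Finset.sum_sub_distrib]
  refine Finset.sum_congr rfl fun k _ ↦ ?_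
  simp [verticalMetric, sq]

theorem verticalDensity_zero_zero (cov : CovariantDerivative (𝓡 n) F V) (σ : ∀ x, V x) (x : M)
    [FiniteDimensional ℝ (TangentSpace (𝓡 n) x)] :
    verticalDensity cov 0 0 σ x =
      ∑ k, ‖cov σ x (stdOrthonormalBasis ℝ (TangentSpace (𝓡 n) x) k)‖ ^ 2 :=
  Finset.sum_congr rfl fun _ _ ↦ verticalMetric_zero_zero _ _

theorem verticalDensity_zero_one_sub_nonneg (cov : CovariantDerivative (𝓡 n) F V)
    (σ : ∀ x, V x) (x : M) :
    0 ≤ verticalDensity cov 0 1 σ x - verticalDensity cov 0 0 σ x := by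
  have : FiniteDimensional ℝ (TangentSpace (𝓡 n) x) :=
    inferInstanceAs (FiniteDimensional ℝ (EuclideanSpace ℝ (Fin n)))
  rw [verticalDensity_zero_one_sub]
  positivity

theorem verticalDensity_zero_one_sub_le (cov : CovariantDerivative (𝓡 n) F V)
    (σ : ∀ x, V x) (x : M) :
    verticalDensity cov 0 1 σ x - verticalDensity cov 0 0 σ x ≤
      ‖σ x‖ ^ 2 * verticalDensity cov 0 0 σ x := by
  have : FiniteDimensional ℝ (TangentSpace (𝓡 n) x) :=
    inferInstanceAs (FiniteDimensional ℝ (EuclideanSpace ℝ (Fin n)))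
  rw [verticalDensity_zero_one_sub, verticalDensity_zero_zero, Finset.mul_sum]
  refine Finset.sum_le_sum fun k _ ↦ ?_
  rw [← sq_abs, ← mul_pow, mul_comm]
  exact pow_le_pow_left₀ (abs_nonneg _) (abs_real_inner_le_norm _ _) 2

theorem cov_eq_zero_of_verticalDensity_eq_zero (cov : CovariantDerivative (𝓡 n) F V)
    (σ : ∀ x, V x) (x : M) (h : verticalDensity cov 0 0 σ x = 0) : cov σ x = 0 := by
  have : FiniteDimensional ℝ (TangentSpace (𝓡 n) x) :=
    inferInstanceAs (FiniteDimensional ℝ (EuclideanSpace ℝ (Fin n)))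
  rw [verticalDensity_zero_zero, Finset.sum_eq_zero_iff_of_nonneg fun k _ ↦ sq_nonneg _] at h
  have hb : (cov σ x).toLinearMap = 0 :=
    (stdOrthonormalBasis ℝ (TangentSpace (𝓡 n) x)).toBasis.ext fun k ↦ by
      simpa using h k (Finset.mem_univ k)
  ext X
  exact congr($hb X)

/-- The first variation of the energy density in the direction `φ σ`. -/
theorem hasDerivAt_verticalDensity_scalingVariation {cov : CovariantDerivative (𝓡 n) F V}
    (hmetric : cov.IsMetricCompatible) (p q : ℝ)
    (hσ : ContMDiff (𝓡 n) ((𝓡 n).prod 𝓘(ℝ, F)) ∞ (fun x ↦ TotalSpace.mk' F x (σ x)))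
    {φ : M → ℝ} (hφ : ContMDiff (𝓡 n) 𝓘(ℝ, ℝ) ∞ φ) (x : M)
    [FiniteDimensional ℝ (TangentSpace (𝓡 n) x)] :
    HasDerivAt (fun t ↦ verticalDensity cov p q (scalingVariation φ σ t) x)
      (2 * (φ x * (1 / (1 + ‖σ x‖ ^ 2)) ^ (p + 1) * variationForm cov p q σ x) +
        ∑ k, mvfderiv (𝓡 n) (fun x ↦ φ x * weight p q (‖σ x‖ ^ 2)) x
            (stdOrthonormalBasis ℝ (TangentSpace (𝓡 n) x) k) *
          mvfderiv (𝓡 n) (fun x ↦ ‖σ x‖ ^ 2) x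
            (stdOrthonormalBasis ℝ (TangentSpace (𝓡 n) x) k)) 0 := by
  simp only [verticalDensity, covariantDerivative_scalingVariation cov hσ hφ]
  refine (HasDerivAt.fun_sum fun k _ ↦ hasDerivAt_verticalMetric p q (φ x)
    (mvfderiv (𝓡 n) φ x (stdOrthonormalBasis ℝ (TangentSpace (𝓡 n) x) k)) (σ x)
    (cov σ x (stdOrthonormalBasis ℝ (TangentSpace (𝓡 n) x) k))).congr_deriv ?_
  rw [Finset.sum_add_distrib]
  congr 1
  · rw [variationForm, verticalDensity_zero_one_sub, verticalDensity_zero_zero]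
    simp only [Finset.mul_sum, ← Finset.sum_add_distrib]
  · refine Finset.sum_congr rfl fun k _ ↦ ?_
    rw [mvfderiv_mul_weight hφ hσ, mvfderiv_norm_sq hmetric hσ]

variable [IsContMDiffRiemannianBundle (𝓡 n) ∞ (EuclideanSpace ℝ (Fin n))
      (fun x : M ↦ TangentSpace (𝓡 n) x)]
  {e : OpenPartialHomeomorph M (EuclideanSpace ℝ (Fin n))}

theorem continuous_variationForm (cov : CovariantDerivative (𝓡 n) F V)
    (hcov : CovariantDerivative.ContMDiffCovariantDerivative cov ∞) (p q : ℝ)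
    (hσ : ContMDiff (𝓡 n) ((𝓡 n).prod 𝓘(ℝ, F)) ∞ (fun x ↦ TotalSpace.mk' F x (σ x))) :
    Continuous (variationForm cov p q σ) := by
  have hd (q : ℝ) : Continuous (verticalDensity cov 0 q σ) := by
    have h := (continuous_deriv_verticalDensity cov hcov 0 q (s := fun _ ↦ σ)
      (hσ.comp contMDiff_fst)).1.comp (Continuous.prodMk_left (0 : ℝ))
    exact h
  have hN := (contMDiff_norm_sq hσ).continuous
  exact (((continuous_const.add hN).sub (continuous_const.mul hN)).mul (hd 0)).add
    ((continuous_const.add (continuous_const.mul hN)).mul ((hd 1).sub (hd 0)))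

variable [MeasurableSpace M] [BorelSpace M]

/-- The zeroth order part of the first variation of a `(p,q)`-harmonic section of harmonic norm
integrates to zero against test functions supported in a chart. -/
theorem setIntegral_variationForm_eq_zero {cov : CovariantDerivative (𝓡 n) F V}
    (hcov : CovariantDerivative.ContMDiffCovariantDerivative cov ∞)
    (hmetric : cov.IsMetricCompatible) (p q : ℝ)
    (hσ : ContMDiff (𝓡 n) ((𝓡 n).prod 𝓘(ℝ, F)) ∞ (fun x ↦ TotalSpace.mk' F x (σ x)))
    (hharm : IsHarmonicFunction n (fun x ↦ ‖σ x‖ ^ 2)) (h : IsHarmonicSection cov p q σ)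
    (he : e ∈ atlas (EuclideanSpace ℝ (Fin n)) M) {K : Set M} (hK : IsCompact K)
    (hKe : K ⊆ e.source) {φ : M → ℝ} (hφ : ContMDiff (𝓡 n) 𝓘(ℝ, ℝ) ∞ φ)
    (hφK : ∀ x ∉ K, φ x = 0) :
    ∫ u in e '' K, volDensity e u * (φ (e.symm u) *
      (1 / (1 + ‖σ (e.symm u)‖ ^ 2)) ^ (p + 1) * variationForm cov p q σ (e.symm u)) = 0 := by
  have hs := isVariation_scalingVariation hσ hφ hφK
  -- Criticality and the explicit first variation give two values for one derivative.
  have h0 := (h K hK _ hs).unique (hasDerivAt_verticalEnergy cov hcov p q hK hs.smooth)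
  have hcont := (continuous_deriv_verticalDensity cov hcov p q
    hs.smooth).2.2.comp (Continuous.prodMk_left (0 : ℝ))
  rw [setIntegral_riemannianVolume he hK hKe (f := fun x ↦
    deriv (fun t ↦ verticalDensity cov p q (scalingVariation φ σ t) x) 0) hcont.continuousOn] at h0
  have hKc := isCompact_chart_image hK hKe
  have hsub := chart_image_subset_target hKe
  set ψ : M → ℝ := fun x ↦ φ x * weight p q (‖σ x‖ ^ 2) with hψdef
  have hψ : ContMDiff (𝓡 n) 𝓘(ℝ, ℝ) ∞ ψ := contMDiff_mul_weight hφ hσ p q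
  have hN := contMDiff_norm_sq hσ
  -- The factor `weight` is absorbed in the test function `ψ`, so only harmonicity of `|σ|²` itself
  -- is needed.
  have hgreen := setIntegral_gradient_inner_eq_zero he hK hKe hψ
    (fun x hx ↦ by simp [hψdef, hφK x hx]) hN hharm
  have hderiv (u) (hu : u ∈ e '' K) :
      volDensity e u * deriv (fun t ↦ verticalDensity cov p q (scalingVariation φ σ t)
        (e.symm u)) 0 =
      2 * (volDensity e u * (φ (e.symm u) * (1 / (1 + ‖σ (e.symm u)‖ ^ 2)) ^ (p + 1) *
        variationForm cov p q σ (e.symm u))) +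
      volDensity e u * ∑ i, ∑ j, (gram e u)⁻¹ i j *
        (partialDeriv i (ψ ∘ e.symm) u * partialDeriv j ((fun x ↦ ‖σ x‖ ^ 2) ∘ e.symm) u) := by
    have : FiniteDimensional ℝ (TangentSpace (𝓡 n) (e.symm u)) :=
      inferInstanceAs (FiniteDimensional ℝ (EuclideanSpace ℝ (Fin n)))
    have htr := sum_orthonormalBasis_eq_sum_coordVec he (hsub hu)
      (stdOrthonormalBasis ℝ (TangentSpace (𝓡 n) (e.symm u)))
      ((LinearMap.mul ℝ ℝ).compl₁₂ (mvfderiv (𝓡 n) ψ (e.symm u)).toLinearMap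
        (mvfderiv (𝓡 n) (fun x ↦ ‖σ x‖ ^ 2) (e.symm u)).toLinearMap)
    simp only [LinearMap.compl₁₂_apply, LinearMap.mul_apply', ContinuousLinearMap.coe_coe,
      mvfderiv_coordVec he (hsub hu) (hψ.mdifferentiableAt (by simp)),
      mvfderiv_coordVec he (hsub hu) (hN.mdifferentiableAt (by simp))] at htr
    rw [(hasDerivAt_verticalDensity_scalingVariation hmetric p q hσ hφ (e.symm u)).deriv, htr]
    ring
  rw [setIntegral_congr_fun hKc.measurableSet hderiv, integral_add, hgreen,
    integral_const_mul] at h0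
  · linarith
  · refine ContinuousOn.integrableOn_compact hKc (ContinuousOn.mul continuousOn_const ?_)
    have hc : Continuous fun x ↦ φ x * (1 / (1 + ‖σ x‖ ^ 2)) ^ (p + 1) *
        variationForm cov p q σ x := by
      have hpos (x : M) : 0 < 1 + ‖σ x‖ ^ 2 := by positivity
      exact (hφ.continuous.mul ((continuous_const.div (continuous_const.add hN.continuous)
        fun x ↦ (hpos x).ne').rpow_const fun x ↦ Or.inl (one_div_pos.2 (hpos x)).ne')).mul
        (continuous_variationForm cov hcov p q hσ)
    exact ((contDiffOn_volDensity he).continuousOn.mono hsub).mul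
      (hc.comp_continuousOn (e.continuousOn_symm.mono hsub))
  · refine ContinuousOn.integrableOn_compact hKc (ContinuousOn.mono ?_ hsub)
    have hP {f : M → ℝ} (hf : ContMDiff (𝓡 n) 𝓘(ℝ, ℝ) ∞ f) (i : Fin n) :=
      (contDiffOn_partialDeriv e.open_target (contDiffOn_comp_chart_symm he hf) i).continuousOn
    exact (contDiffOn_volDensity he).continuousOn.mul (continuousOn_finsetSum _ fun i _ ↦
      continuousOn_finsetSum _ fun j _ ↦ (contDiffOn_gram_inv he i j).continuousOn.mul
        ((hP hψ i).mul (hP hN j)))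

theorem isParallel_of_isHarmonicSection {cov : CovariantDerivative (𝓡 n) F V}
    (hcov : CovariantDerivative.ContMDiffCovariantDerivative cov ∞)
    (hmetric : cov.IsMetricCompatible)
    (hσ : ContMDiff (𝓡 n) ((𝓡 n).prod 𝓘(ℝ, F)) ∞ (fun x ↦ TotalSpace.mk' F x (σ x)))
    {μ p q : ℝ} (hμ : 1 / 2 ≤ μ) (hpq : (p, q) ∈ region μ)
    (hR : IsRiemannianSection (μ * q) σ)
    (hharm : IsHarmonicFunction n (fun x ↦ ‖σ x‖ ^ 2)) (h : IsHarmonicSection cov p q σ) :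
    IsParallel cov σ := by
  intro x₀
  have hbound (x : M) := exists_pos_mul_le_of_mem_region hμ hpq (sq_nonneg ‖σ x‖) (hR x)
    (verticalDensity_zero_nonneg cov σ x) (verticalDensity_zero_one_sub_nonneg cov σ x)
    (verticalDensity_zero_one_sub_le cov σ x)
  have hQ (x : M) : 0 ≤ variationForm cov p q σ x := by
    obtain ⟨c, hc, hle⟩ := hbound x
    exact (mul_nonneg hc.le (verticalDensity_zero_nonneg cov σ x)).trans hle
  suffices hx : variationForm cov p q σ x₀ = 0 by
    obtain ⟨c, hc, hle⟩ := hbound x₀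
    refine cov_eq_zero_of_verticalDensity_eq_zero cov σ x₀
      (le_antisymm ?_ (verticalDensity_zero_nonneg cov σ x₀))
    rw [variationForm] at hx
    rw [hx] at hle
    exact nonpos_of_mul_nonpos_right hle hc
  obtain ⟨φ⟩ : Nonempty (SmoothBumpFunction (𝓡 n) x₀) := inferInstance
  set e := chartAt (EuclideanSpace ℝ (Fin n)) x₀ with hedef
  have he : e ∈ atlas (EuclideanSpace ℝ (Fin n)) M := chart_mem_atlas _ x₀
  have hK : IsCompact (tsupport φ) := φ.hasCompactSupport
  have hKe : tsupport φ ⊆ e.source := φ.tsupport_subset_chartAt_source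
  have hKc := isCompact_chart_image hK hKe
  have hsub := chart_image_subset_target hKe
  have hint := setIntegral_variationForm_eq_zero hcov hmetric p q hσ hharm h he hK hKe φ.contMDiff
    fun x hx ↦ image_eq_zero_of_notMem_tsupport hx
  have hpos (x : M) : 0 < 1 + ‖σ x‖ ^ 2 := by positivity
  have hc : Continuous fun x ↦ φ x * (1 / (1 + ‖σ x‖ ^ 2)) ^ (p + 1) *
      variationForm cov p q σ x :=
    (φ.continuous.mul ((continuous_const.div (continuous_const.add (contMDiff_norm_sq
      hσ).continuous) fun x ↦ (hpos x).ne').rpow_const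
        fun x ↦ Or.inl (one_div_pos.2 (hpos x)).ne')).mul
      (continuous_variationForm cov hcov p q hσ)
  have hcont : ContinuousOn (fun u ↦ volDensity e u * (φ (e.symm u) *
      (1 / (1 + ‖σ (e.symm u)‖ ^ 2)) ^ (p + 1) * variationForm cov p q σ (e.symm u))) e.target :=
    (contDiffOn_volDensity he).continuousOn.mul (hc.comp_continuousOn e.continuousOn_symm)
  rw [setIntegral_eq_zero_iff_of_nonneg_ae
    ((ae_restrict_iff' hKc.measurableSet).2 (Filter.Eventually.of_forall fun u hu ↦
      mul_nonneg (volDensity_pos he (hsub hu)).le (mul_nonneg (mul_nonneg φ.nonneg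
        (Real.rpow_nonneg (one_div_pos.2 (hpos _)).le _)) (hQ _))))
    ((hcont.mono hsub).integrableOn_compact hKc)] at hint
  have hU : IsOpen (e '' Function.support φ) :=
    e.isOpen_image_of_subset_source φ.isOpen_support φ.support_subset_source
  have hUK : e '' Function.support φ ⊆ e '' tsupport φ := Set.image_mono subset_closure
  -- A nonnegative integrand with zero integral vanishes almost everywhere, hence by continuity
  -- everywhere on the open image of the support of `φ`, in particular at `e x₀`.
  have hzero := Measure.eqOn_open_of_ae_eq (ae_restrict_of_ae_restrict_of_subset hUK hint) hU
    (hcont.mono (hUK.trans hsub)) continuousOn_const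
    (Set.mem_image_of_mem e φ.c_mem_support)
  have hx₀ : e.symm (e x₀) = x₀ := e.left_inv (mem_chart_source _ x₀)
  have hφ : φ (e.symm (e x₀)) = 1 := by rw [hx₀, φ.eq_one]
  simp only [hφ, one_mul, Pi.zero_apply] at hzero
  have hx := (mul_eq_zero.1 ((mul_eq_zero.1 hzero).resolve_left
    (volDensity_pos he (mem_chart_target _ x₀)).ne')).resolve_left
    (Real.rpow_pos_of_pos (one_div_pos.2 (hpos _)) _).ne'
  rwa [hx₀] at hx

end ScalingVariation

end PQHarmonic

theorem theorem4p3
    {n : ℕ} {M : Type*} [TopologicalSpace M] [T2Space M] [SigmaCompactSpace M]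
    [MeasurableSpace M] [BorelSpace M]
    [ChartedSpace (EuclideanSpace ℝ (Fin n)) M] [IsManifold (𝓡 n) ∞ M]
    [RiemannianBundle (fun x : M ↦ TangentSpace (𝓡 n) x)]
    [IsContMDiffRiemannianBundle (𝓡 n) ∞ (EuclideanSpace ℝ (Fin n))
      (fun x : M ↦ TangentSpace (𝓡 n) x)]
    {F : Type*} [NormedAddCommGroup F] [NormedSpace ℝ F] [FiniteDimensional ℝ F]
    {V : M → Type*} [TopologicalSpace (TotalSpace F V)]
    [∀ x, NormedAddCommGroup (V x)] [∀ x, InnerProductSpace ℝ (V x)]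
    [FiberBundle F V] [VectorBundle ℝ F V] [ContMDiffVectorBundle ∞ F V (𝓡 n)]
    [IsContMDiffRiemannianBundle (𝓡 n) ∞ F V]
    (cov : CovariantDerivative (𝓡 n) F V)
    (hsmooth : CovariantDerivative.ContMDiffCovariantDerivative cov ∞)
    (hmetric : cov.IsMetricCompatible)
    (σ : ∀ x, V x)
    (hσ : ContMDiff (𝓡 n) ((𝓡 n).prod 𝓘(ℝ, F)) ∞ (fun x ↦ TotalSpace.mk' F x (σ x)))
    (μ p q : ℝ) (hμ : 1 / 2 ≤ μ) (hpq : (p, q) ∈ PQHarmonic.region μ)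
    (hR : PQHarmonic.IsRiemannianSection (μ * q) σ)
    (hharm : PQHarmonic.IsHarmonicFunction n (fun x ↦ ‖σ x‖ ^ 2)) :
    PQHarmonic.IsHarmonicSection cov p q σ ↔ PQHarmonic.IsParallel cov σ :=
  ⟨PQHarmonic.isParallel_of_isHarmonicSection hsmooth hmetric hσ hμ hpq hR hharm,
    PQHarmonic.isHarmonicSection_of_isParallel cov hsmooth p q⟩
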